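/- Let $I$ be a finite set and $\Omega=(\Omega_{ij})_{i,j\in I}$ an integer matrix such that $\Omega_{ii}>0$; $\Omega_{ij}\le 0$ and $(\Omega_{ij}+\Omega_{ji})/\Omega_{ii}\in\mathbb Z_{\le 0}$ for $i\neq j$; and $\gcd_i \Omega_{ii}=1$. Let $\langle\,,\rangle$ be the bilinear form on $\mathbb Z[I]$ with $\langle i,j\rangle=\Omega_{ij}$, and put $\lambda\cdot\mu=\langle\lambda,\mu\rangle+\langle\mu,\lambda\rangle$, $\{\lambda,\mu\}=v^{\lambda\cdot\mu}t^{\langle\mu,\lambda\rangle-\langle\lambda,\mu\rangle}$, $v_i=v^{\Omega_{ii}}$, $t_i=t^{\Omega_{ii}}$, $[n]_{v,t}=\frac{(vt)^n-(vt^{-1})^{-n}}{vt-(vt^{-1})^{-1}}$, $[n]^!_{v,t}=\prod_{k=1}^n[k]_{v,t}$. Let $U=U_{v,t}$ be the $\mathbb Q(v,t)$-algebra with generators $E_i,F_i,K_i^{\pm1},K_i'^{\pm1}$ ($i\in I$) and relations $K_i^{\pm1}K_i^{\mp1}=K_i'^{\pm1}K_i'^{\mp1}=1$; $K_iE_jK_i^{-1}=v^{i\cdot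 j}t^{\langle j,i\rangle-\langle i,j\rangle}E_j$, $K'_iE_jK_i'^{-1}=v^{-i\cdot j}t^{\langle j,i\rangle-\langle i,j\rangle}E_j$, $K'_iF_jK_i'^{-1}=v^{i\cdot j}t^{\langle i,j\rangle-\langle j,i\rangle}F_j$, $K_iF_jK_i^{-1}=v^{-i\cdot j}t^{\langle i,j\rangle-\langle j,i\rangle}F_j$; $E_iF_j-F_jE_i=\delta_{ij}\frac{K_i-K'_i}{v_i-v_i^{-1}}$; and, for $i\ne j$, with $X_i^{(p)}=X_i^p/[p]^!_{v_i,t_i}$, both $\sum_{p+p'}(-1)^p t^{-p(\Omega_{ii}p'-\Omega_{ij}+\Omega_{ji})}E_i^{(p)}E_jE_i^{(p')}=0$ and $\sum_{p+p'}(-1)^p t^{-p(\Omega_{ii}p'-\Omega_{ij}+\Omega_{ji})}F_i^{(p')}F_jF_i^{(p)}=0$, the sums being over $p,p'\ge0$ with $p+p'=1-(\Omega_{ij}+\Omega_{ji})/\Omega_{ii}$. Let $(\,,)_\phi$ be the skew-Hopf pairing between the subalgebras $U_{\ge0}$ (generated by $E_i,K_i^{\pm1}$) and $U_{\le0}$ (generated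 by $F_i,K_i'^{\pm1}$) with $(E_i,F_j)_\phi=\delta_{ij}(v_i^{-1}-v_i)^{-1}$, $(K_\mu,K'_\nu)_\phi=\{\mu,\nu\}$, $(E_i,K'_j)_\phi=(K_i,F_j)_\phi=0$, $(x,yy')_\phi=(\Delta x,y\otimes y')_\phi$, $(xx',y)_\phi=(x\otimes x',\Delta^{op}y)_\phi$, where $\Delta(K_i)=K_i\otimes K_i$, $\Delta(K'_i)=K'_i\otimes K'_i$, $\Delta(E_i)=E_i\otimes1+K_i\otimes E_i$, $\Delta(F_i)=1\otimes F_i+F_i\otimes K'_i$. For $\mu\in\mathbb N[I]$ let $U^+_\mu$ and $U^-_{-\mu}$ be the spans of the monomials of degree $\mu$ in the $E_i$ and in the $F_i$; they are nondegenerately paired by $(\,,)_\phi$. Put $\Theta_\mu=\sum_{b} b\otimes b^*$, where $b$ runs over any basis of $U^-_{-\mu}$ and $(b^*)$ is the dual basis of $U^+_\mu$. A $U$-module $M$ is a weight module if $M=\bigoplus_{\lambda\in\mathbb Z[I]}M_\lambda$, where $M_\lambda$ is the space of $m\in M$ with $K_im=v^{i\cdot\lambda}t^{\langle\lambda,i\rangle-\langle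 i,\lambda\rangle}m$ and $K'_im=v^{-i\cdot\lambda}t^{\langle\lambda,i\rangle-\langle i,\lambda\rangle}m$ for all $i\in I$. For finite-dimensional weight modules $M,M'$ let $P:M\otimes M'\to M'\otimes M$ be the flip, let $\tilde f$ be the linear map on $M'\otimes M$ with $\tilde f(m'\otimes m)=\{\lambda,\mu\}^{-1}\,m'\otimes m$ for $m'\in M'_\lambda$, $m\in M_\mu$, let $\Theta=\sum_{\mu\in\mathbb N[I]}\Theta_\mu$ act on $M'\otimes M$ (only finitely many terms act nontrivially), and let $\mathcal R_{M,M'}=\Theta\circ\tilde f\circ P:M\otimes M'\to M'\otimes M$. On triple tensor products write $\mathcal R_{12}=\mathcal R\otimes\mathrm{Id}$ and $\mathcal R_{23}=\mathrm{Id}\otimes\mathcal R$. Then for all finite-dimensional weight $U$-modules $M_1,M_2,M_3$, $$\mathcal R_{12}\circ\mathcal R_{23}\circ\mathcal R_{12}=\mathcal R_{23}\circ\mathcal R_{12}\circ\mathcal R_{23}:\ M_1\otimes M_2\otimes M_3\to M_3\otimes M_2\otimes M_1 .$$ -/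

import Mathlib

open scoped TensorProduct

universe u

noncomputable section

namespace TwoParam

/-! ### The ground field and the bilinear forms -/

/-- The field `ℚ(v,t)` of rational functions in two indeterminates. -/
def 𝕜 : Type := FractionRing (MvPolynomial (Fin 2) ℚ)

instance instFieldK : Field 𝕜 := inferInstanceAs (Field (FractionRing (MvPolynomial (Fin 2) ℚ)))

/-- The indeterminate `v`. -/
def v : 𝕜 :=
  algebraMap (MvPolynomial (Fin 2) ℚ) (FractionRing (MvPolynomial (Fin 2) ℚ)) (MvPolynomial.X 0)

/-- The indeterminate `t`. -/
def t : 𝕜 :=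
  algebraMap (MvPolynomial (Fin 2) ℚ) (FractionRing (MvPolynomial (Fin 2) ℚ)) (MvPolynomial.X 1)

variable {I : Type u} [Fintype I] [DecidableEq I]

/-- The conditions on the integer matrix `Ω` (over a finite index set) that encodes the Cartan
datum; the symmetric form of the Cartan datum is `i · j = Ω i j + Ω j i`. -/
structure IsCartan (Ω : I → I → ℤ) : Prop where
  diag_pos : ∀ i, 0 < Ω i i
  offdiag_nonpos : ∀ i j, i ≠ j → Ω i j ≤ 0
  dvd : ∀ i j, i ≠ j → Ω i i ∣ Ω i j + Ω j i
  gcd_eq_one : Finset.univ.gcd (fun i => Ω i i) = 1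

variable (Ω : I → I → ℤ)

/-- `⟨lam, mu⟩`, the bilinear form on `ℤ[I]` with `⟨i, j⟩ = Ω i j`. -/
def ang (lam mu : I → ℤ) : ℤ := ∑ i, ∑ j, lam i * Ω i j * mu j

/-- `lam · mu = ⟨lam, mu⟩ + ⟨mu, lam⟩`. -/
def dot (lam mu : I → ℤ) : ℤ := ang Ω lam mu + ang Ω mu lam

/-- The multiplicative form `{lam, mu} = v ^ (lam · mu) * t ^ (⟨mu, lam⟩ - ⟨lam, mu⟩)`. -/
def brace (lam mu : I → ℤ) : 𝕜 :=
  v ^ dot Ω lam mu * t ^ (ang Ω mu lam - ang Ω lam mu)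

/-- The element `i` of `ℤ[I]`. -/
def e (i : I) : I → ℤ := Pi.single i 1

/-- `v_i = v ^ (i·i/2)`, where `i·i/2 = Ω i i`. -/
def vi (i : I) : 𝕜 := v ^ Ω i i

/-- `t_i = t ^ (i·i/2)`. -/
def ti (i : I) : 𝕜 := t ^ Ω i i

/-- The two-parameter quantum integer `[n]_{a,b}`. -/
def qint (a b : 𝕜) (n : ℕ) : 𝕜 :=
  ((a * b) ^ n - ((a * b⁻¹) ^ n)⁻¹) / (a * b - (a * b⁻¹)⁻¹)

/-- The quantum factorial `[n]!_{a,b}`. -/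
def qfact (a b : 𝕜) (n : ℕ) : 𝕜 := ∏ k ∈ Finset.range n, qint a b (k + 1)

/-! ### The algebra `U_{v,t}` -/

/-- Generators of `U_{v,t}`; `Ki`, `Ki'` stand for the inverses of `K`, `K'`. -/
inductive Gen (I : Type u) : Type u
  | E (i : I) | F (i : I) | K (i : I) | Ki (i : I) | K' (i : I) | Ki' (i : I)

/-- The free algebra on the generators of `U_{v,t}`. -/
abbrev FreeGen (I : Type u) : Type u := FreeAlgebra 𝕜 (Gen I)

/-- A generator as an element of the free algebra. -/
abbrev g (x : Gen I) : FreeGen I := FreeAlgebra.ι 𝕜 x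

/-- `1 - 2 (i·j)/(i·i)`. -/
def serreN (i j : I) : ℕ := (1 - (Ω i j + Ω j i) / Ω i i).toNat

/-- The coefficient `(-1)^p t_i ^ (-p (p' - 2⟨i,j⟩/(i·i) + 2⟨j,i⟩/(i·i)))`, divided by
`[p]!_{v_i,t_i} [p']!_{v_i,t_i}`; the exponent of `t` is cleared of denominators by
`i·i/2 = Ω i i`. -/
def serreCoeff (i j : I) (p p' : ℕ) : 𝕜 :=
  (-1) ^ p * t ^ (-(p : ℤ) * (Ω i i * p' - Ω i j + Ω j i)) /
    (qfact (vi Ω i) (ti Ω i) p * qfact (vi Ω i) (ti Ω i) p')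

open Gen in
/-- The defining relations (R1)-(R4) of `U_{v,t}`. -/
inductive Rel : FreeGen I → FreeGen I → Prop
  | K_Ki (i : I) : Rel (g (K i) * g (Ki i)) 1
  | Ki_K (i : I) : Rel (g (Ki i) * g (K i)) 1
  | K'_Ki' (i : I) : Rel (g (K' i) * g (Ki' i)) 1
  | Ki'_K' (i : I) : Rel (g (Ki' i) * g (K' i)) 1
  | K_E (i j : I) : Rel (g (K i) * g (E j) * g (Ki i))
      ((v ^ (Ω i j + Ω j i) * t ^ (Ω j i - Ω i j)) • g (E j))
  | K'_E (i j : I) : Rel (g (K' i) * g (E j) * g (Ki' i))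
      ((v ^ (-(Ω i j + Ω j i)) * t ^ (Ω j i - Ω i j)) • g (E j))
  | K'_F (i j : I) : Rel (g (K' i) * g (F j) * g (Ki' i))
      ((v ^ (Ω i j + Ω j i) * t ^ (Ω i j - Ω j i)) • g (F j))
  | K_F (i j : I) : Rel (g (K i) * g (F j) * g (Ki i))
      ((v ^ (-(Ω i j + Ω j i)) * t ^ (Ω i j - Ω j i)) • g (F j))
  | E_F_same (i : I) : Rel (g (E i) * g (F i) - g (F i) * g (E i))
      ((vi Ω i - (vi Ω i)⁻¹)⁻¹ • (g (K i) - g (K' i)))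
  | E_F_ne (i j : I) (h : i ≠ j) : Rel (g (E i) * g (F j) - g (F j) * g (E i)) 0
  | serre_E (i j : I) (h : i ≠ j) :
      Rel (∑ p ∈ Finset.HasAntidiagonal.antidiagonal (serreN Ω i j),
        serreCoeff Ω i j p.1 p.2 • (g (E i) ^ p.1 * g (E j) * g (E i) ^ p.2)) 0
  | serre_F (i j : I) (h : i ≠ j) :
      Rel (∑ p ∈ Finset.HasAntidiagonal.antidiagonal (serreN Ω i j),
        serreCoeff Ω i j p.1 p.2 • (g (F i) ^ p.2 * g (F j) * g (F i) ^ p.1)) 0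

/-- The two-parameter quantum algebra `U_{v,t}` of the Cartan datum `Ω`. -/
def U : Type u := RingQuot (Rel Ω)

instance instRingU : Ring (U Ω) := inferInstanceAs (Ring (RingQuot (Rel Ω)))

instance instAlgebraU : Algebra 𝕜 (U Ω) := inferInstanceAs (Algebra 𝕜 (RingQuot (Rel Ω)))

/-- The quotient map from the free algebra. -/
def mkU : FreeGen I →ₐ[𝕜] U Ω := RingQuot.mkAlgHom 𝕜 (Rel Ω)

theorem mkU_rel {a b : FreeGen I} (h : Rel Ω a b) : mkU Ω a = mkU Ω b :=
  RingQuot.mkAlgHom_rel 𝕜 h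

/-- The image of a generator in `U_{v,t}`. -/
def gen (x : Gen I) : U Ω := mkU Ω (g x)

/-! ### The free algebra `'f` and its images in `U_{v,t}` -/

/-- The free algebra `'f` on symbols `θ_i`. -/
abbrev FF (I : Type u) : Type u := FreeAlgebra 𝕜 I

/-- The algebra map `'f → U⁺`, `θ_i ↦ E_i`. -/
def plus : FF I →ₐ[𝕜] U Ω := FreeAlgebra.lift 𝕜 (fun i => gen Ω (Gen.E i))

/-- The (`ℚ(v,t)`-linear) algebra map `'f → U⁻`, `θ_i ↦ F_i`. -/
def minus : FF I →ₐ[𝕜] U Ω := FreeAlgebra.lift 𝕜 (fun i => gen Ω (Gen.F i))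

/-- The monomial `θ_{i₁} ⋯ θ_{iₗ}`. -/
def word (w : List I) : FF I := (w.map (FreeAlgebra.ι 𝕜)).prod

/-- The subspace `'f_mu` of homogeneous elements of degree `mu ∈ ℕ[I]`. -/
def homog (mu : I → ℕ) : Submodule 𝕜 (FF I) :=
  Submodule.span 𝕜 {x | ∃ w : List I, (∀ i, w.count i = mu i) ∧ x = word w}

/-! ### The skew-Hopf pairing

The skew-Hopf pairing `(,)_φ` between `U_{≥0}` and `U_{≤0}` is constructed on free covers of these
algebras.  It is characterised by the values on generators together with
`(x, y y') = (Δ x, y ⊗ y')` and `(x x', y) = (x ⊗ x', Δᵒᵖ y)`.  On the generators of the second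
factor, the latter rule says that `(·, K'_j)` is multiplicative and that
`(x x', F_j) = (x, F_j) ε(x') + (x, K'_j) (x', F_j)`. -/

/-- Generators of a free cover of `U_{≥0}` (`x = E`, `k = K`, `ki = K⁻¹`) or of `U_{≤0}`
(`x = F`, `k = K'`, `ki = K'⁻¹`). -/
inductive BGen (I : Type u) : Type u
  | x (i : I) | k (i : I) | ki (i : I)

/-- The free algebra on Borel generators. -/
abbrev Borel (I : Type u) : Type u := FreeAlgebra 𝕜 (BGen I)

/-- The coproduct on the cover of `U_{≥0}`: `Δ E_i = E_i ⊗ 1 + K_i ⊗ E_i`,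
`Δ K_i^{±1} = K_i^{±1} ⊗ K_i^{±1}`. -/
def comulPos : Borel I →ₐ[𝕜] Borel I ⊗[𝕜] Borel I :=
  FreeAlgebra.lift 𝕜 fun
    | .x i => FreeAlgebra.ι 𝕜 (.x i) ⊗ₜ 1 + FreeAlgebra.ι 𝕜 (.k i) ⊗ₜ FreeAlgebra.ι 𝕜 (.x i)
    | .k i => FreeAlgebra.ι 𝕜 (.k i) ⊗ₜ FreeAlgebra.ι 𝕜 (.k i)
    | .ki i => FreeAlgebra.ι 𝕜 (.ki i) ⊗ₜ FreeAlgebra.ι 𝕜 (.ki i)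

/-- The counit on the cover of `U_{≥0}`. -/
def counitPos : Borel I →ₐ[𝕜] 𝕜 :=
  FreeAlgebra.lift 𝕜 fun
    | .x _ => 0
    | .k _ => 1
    | .ki _ => 1

/-- `x ↦ !![(x, K'_j), (x, F_j); 0, ε(x)]`, an algebra homomorphism by the rules for
`(x x', K'_j)` and `(x x', F_j)`; here `(E_i, F_j) = δ_ij (v_i⁻¹ - v_i)⁻¹`,
`(K_i, K'_j) = {i, j}`, `(E_i, K'_j) = 0` and `(K_i, F_j) = 0`. -/
def pairGen (j : I) : Borel I →ₐ[𝕜] Matrix (Fin 2) (Fin 2) 𝕜 :=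
  FreeAlgebra.lift 𝕜 fun
    | .x i => !![0, if i = j then ((vi Ω i)⁻¹ - vi Ω i)⁻¹ else 0; 0, 0]
    | .k i => !![brace Ω (e i) (e j), 0; 0, 1]
    | .ki i => !![(brace Ω (e i) (e j))⁻¹, 0; 0, 1]

/-- `x ↦ (x, K'_j⁻¹)`. -/
def pairKinv (j : I) : Borel I →ₐ[𝕜] 𝕜 :=
  FreeAlgebra.lift 𝕜 fun
    | .x _ => 0
    | .k i => (brace Ω (e i) (e j))⁻¹
    | .ki i => brace Ω (e i) (e j)

/-- The functional `(·, y)` for a generator `y` of the cover of `U_{≤0}`. -/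
def pairFun : BGen I → (Borel I →ₗ[𝕜] 𝕜)
  | .x j => Matrix.entryLinearMap 𝕜 𝕜 0 1 ∘ₗ (pairGen Ω j).toLinearMap
  | .k j => Matrix.entryLinearMap 𝕜 𝕜 0 0 ∘ₗ (pairGen Ω j).toLinearMap
  | .ki j => (pairKinv Ω j).toLinearMap

/-- `x ↦ ∑ f(x₁) x₂`, where `Δ x = ∑ x₁ ⊗ x₂`. -/
def contract (f : Borel I →ₗ[𝕜] 𝕜) : Module.End 𝕜 (Borel I) :=
  (TensorProduct.lid 𝕜 (Borel I)).toLinearMap ∘ₗ f.rTensor (Borel I) ∘ₗ comulPos.toLinearMap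

/-- `y ↦ (x ↦ ∑ (x₁, y) x₂)`.  It reverses products because `(x, y y') = ∑ (x₁, y) (x₂, y')`. -/
def contractHom : Borel I →ₐ[𝕜] (Module.End 𝕜 (Borel I))ᵐᵒᵖ :=
  FreeAlgebra.lift 𝕜 fun y => MulOpposite.op (contract (pairFun Ω y))

/-- The skew-Hopf pairing `(x, y)_φ`, on free covers of `U_{≥0}` and `U_{≤0}`. -/
def pairing : Borel I →ₗ[𝕜] Borel I →ₗ[𝕜] 𝕜 :=
  LinearMap.mk₂ 𝕜 (fun x y => counitPos ((contractHom Ω y).unop x))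
    (by intros; simp) (by intros; simp) (by intros; simp) (by intros; simp)

/-- The embedding of `'f` into the free Borel algebra. -/
def toBorel : FF I →ₐ[𝕜] Borel I := FreeAlgebra.lift 𝕜 (fun i => FreeAlgebra.ι 𝕜 (BGen.x i))

/-- The pairing `(x⁺, y⁻)_φ` for `x, y ∈ 'f`. -/
def pair : FF I →ₗ[𝕜] FF I →ₗ[𝕜] 𝕜 :=
  (pairing Ω).compl₁₂ toBorel.toLinearMap toBorel.toLinearMap

/-! ### The quasi-R-matrix -/

/-- A choice, for every `mu ∈ ℕ[I]`, of dual bases `b`, `b*` for the nondegenerate pairing between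
the degree `mu` parts of the quotients of `'f` by the left and the right radical of `(x⁺, y⁻)_φ`
(that is, of `U⁻_{-mu}` and `U⁺_mu`), given by representatives in `'f_mu`.  Linear independence of
`b`, and the fact that `b*` spans as well, follow from `dual` and `span`. -/
structure DualBases where
  n : (I → ℕ) → ℕ
  b : ∀ mu, Fin (n mu) → FF I
  bstar : ∀ mu, Fin (n mu) → FF I
  b_mem : ∀ mu k, b mu k ∈ homog mu
  bstar_mem : ∀ mu k, bstar mu k ∈ homog mu
  dual : ∀ mu k l, pair Ω (bstar mu k) (b mu l) = if k = l then 1 else 0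
  span : ∀ mu, ∀ y ∈ homog mu, ∃ c : Fin (n mu) → 𝕜,
    ∀ x ∈ homog mu, pair Ω x (y - ∑ k, c k • b mu k) = 0

/-- The homogeneous parts of `'f` are finite-dimensional. -/
theorem finiteDimensional_homog (mu : I → ℕ) : FiniteDimensional 𝕜 (homog mu) := by
  apply FiniteDimensional.span_of_finite
  refine ((List.finite_length_eq I (∑ i, mu i)).image word).subset ?_
  rintro x ⟨w, hw, rfl⟩
  refine ⟨w, ?_, rfl⟩
  change w.length = _
  rw [← Finset.sum_congr rfl (fun i _ => hw i)]
  simpa using (Multiset.sum_count_eq_card (s := Finset.univ) (m := (w : Multiset I))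
    (by intros; simp)).symm

/-- Dual bases of a bilinear form modulo its radicals. -/
theorem exists_dual_families {k V W : Type*} [Field k] [AddCommGroup V] [Module k V]
    [AddCommGroup W] [Module k W] [FiniteDimensional k V] (B : W →ₗ[k] V →ₗ[k] k) :
    ∃ (n : ℕ) (b : Fin n → W) (bs : Fin n → V),
      (∀ i j, B (b j) (bs i) = if i = j then 1 else 0) ∧
      ∀ y, ∃ c : Fin n → k, B (y - ∑ i, c i • b i) = 0 := by
  obtain ⟨R, hR⟩ : ∃ R : Submodule k (V →ₗ[k] k), R = LinearMap.range B := ⟨_, rfl⟩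
  have hmem : ∀ y, B y ∈ R := fun y => hR ▸ ⟨y, rfl⟩
  have : Module.Free k R := Module.Free.of_divisionRing k R
  let bas := Module.finBasis k R
  let ev : V →ₗ[k] Module.Dual k R := R.subtype.flip
  have hev : Function.Surjective ev := by
    rw [← LinearMap.dualMap_injective_iff, injective_iff_map_eq_zero]
    intro φ hφ
    obtain ⟨r, rfl⟩ := (Module.evalEquiv k R).surjective φ
    have hr : r = 0 := by
      apply Subtype.ext
      ext x
      simpa [ev] using LinearMap.congr_fun hφ x
    simp [hr]
  choose b hb using fun i => (hR.le (bas i).2 : (bas i : V →ₗ[k] k) ∈ LinearMap.range B)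
  choose bs hbs using fun i => hev (bas.coord i)
  refine ⟨_, b, bs, ?_, ?_⟩
  · intro i j
    have h2 : B (b j) (bs i) = ev (bs i) (bas j) := by rw [hb]; rfl
    rw [h2, hbs]
    simp [Finsupp.single_apply, eq_comm]
  · intro y
    refine ⟨fun i => bas.repr ⟨B y, hmem y⟩ i, ?_⟩
    have h := congrArg R.subtype (bas.sum_repr ⟨B y, hmem y⟩)
    simp only [map_sum, map_smul, Submodule.subtype_apply] at h
    simp only [map_sub, map_sum, map_smul, hb]
    rw [h, sub_self]

/-- Dual bases exist. -/
theorem nonempty_dualBases : Nonempty (DualBases Ω) := by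
  have key : ∀ mu : I → ℕ, ∃ (n : ℕ) (b bs : Fin n → FF I), (∀ k, b k ∈ homog mu) ∧
      (∀ k, bs k ∈ homog mu) ∧ (∀ k l, pair Ω (bs k) (b l) = if k = l then 1 else 0) ∧
      ∀ y ∈ homog mu, ∃ c : Fin n → 𝕜,
        ∀ x ∈ homog mu, pair Ω x (y - ∑ k, c k • b k) = 0 := by
    intro mu
    have := finiteDimensional_homog mu
    obtain ⟨n, b, bs, h1, h2⟩ := exists_dual_families
      ((pair Ω).compl₁₂ (homog mu).subtype (homog mu).subtype).flip
    refine ⟨n, fun k => b k, fun k => bs k, fun k => (b k).2, fun k => (bs k).2,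
      fun k l => h1 k l, fun y hy => ?_⟩
    obtain ⟨c, hc⟩ := h2 ⟨y, hy⟩
    refine ⟨c, fun x hx => ?_⟩
    simpa using LinearMap.congr_fun hc ⟨x, hx⟩
  choose n b bs h1 h2 h3 h4 using key
  exact ⟨⟨n, b, bs, h1, h2, h3, h4⟩⟩

variable {Ω}

/-- `Θ_mu = ∑ b ⊗ b* ∈ U⁻ ⊗ U⁺`. -/
def DualBases.theta (D : DualBases Ω) (mu : I → ℕ) : U Ω ⊗[𝕜] U Ω :=
  ∑ k, minus Ω (D.b mu k) ⊗ₜ[𝕜] plus Ω (D.bstar mu k)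

variable (Ω)

/-! ### Weight modules and the R-matrix -/

section Modules

variable (M : Type*) [AddCommGroup M] [Module 𝕜 M] [Module (U Ω) M] [IsScalarTower 𝕜 (U Ω) M]
variable (M' : Type*) [AddCommGroup M'] [Module 𝕜 M'] [Module (U Ω) M']
  [IsScalarTower 𝕜 (U Ω) M']

/-- `U_{v,t}` acting on a module by `ℚ(v,t)`-linear maps. -/
def act : U Ω →ₐ[𝕜] Module.End 𝕜 M := Algebra.lsmul 𝕜 𝕜 M

/-- `c_{i,lam} = t ^ (⟨lam, i⟩ - ⟨i, lam⟩)`. -/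
def cc (i : I) (lam : I → ℤ) : 𝕜 := t ^ (ang Ω lam (e i) - ang Ω (e i) lam)

/-- The weight space `M_lam`, on which `K_i` acts by `v ^ (i·lam) c_{i,lam}` and `K'_i` acts by
`v ^ (-i·lam) c_{i,lam}`. -/
def weightSpace (lam : I → ℤ) : Submodule 𝕜 M where
  carrier := {m | ∀ i,
    gen Ω (Gen.K i) • m = (v ^ dot Ω (e i) lam * cc Ω i lam) • m ∧
    gen Ω (Gen.K' i) • m = (v ^ (-dot Ω (e i) lam) * cc Ω i lam) • m}
  zero_mem' := by intro i; simp
  add_mem' := by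
    intro a b ha hb i
    simp only [smul_add, (ha i).1, (ha i).2, (hb i).1, (hb i).2, and_self]
  smul_mem' := by
    intro c a ha i
    exact ⟨by rw [smul_comm, (ha i).1, smul_comm], by rw [smul_comm, (ha i).2, smul_comm]⟩

/-- `M` is a weight module: `M = ⨁_{lam ∈ ℤ[I]} M_lam`. -/
class IsWeightModule : Prop where
  isInternal : DirectSum.IsInternal (weightSpace Ω M)

/-- The identification of a weight module with the direct sum of its weight spaces. -/
def decomp [IsWeightModule Ω M] : (DirectSum (I → ℤ) fun lam => weightSpace Ω M lam) ≃ₗ[𝕜] M :=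
  LinearEquiv.ofBijective (DirectSum.coeLinearMap (weightSpace Ω M)) IsWeightModule.isInternal

/-- `f(lam, mu) = (K_lam, K'_mu)_φ⁻¹`. -/
def f (lam mu : I → ℤ) : 𝕜 := (brace Ω lam mu)⁻¹

/-- The linear map `f̃` on `M ⊗ M'` with `f̃ (m ⊗ m') = f(lam, mu) m ⊗ m'` for `m ∈ M_lam`,
`m' ∈ M'_mu`. -/
def ftilde [IsWeightModule Ω M] [IsWeightModule Ω M'] : M ⊗[𝕜] M' →ₗ[𝕜] M ⊗[𝕜] M' :=
  TensorProduct.lift <|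
    DirectSum.toModule 𝕜 (I → ℤ) (M' →ₗ[𝕜] M ⊗[𝕜] M') (fun lam =>
      (LinearMap.flip <|
        DirectSum.toModule 𝕜 (I → ℤ) (weightSpace Ω M lam →ₗ[𝕜] M ⊗[𝕜] M') (fun mu =>
          f Ω lam mu • ((TensorProduct.mk 𝕜 M M').compl₁₂
            (weightSpace Ω M lam).subtype (weightSpace Ω M' mu).subtype).flip)
        ∘ₗ (decomp Ω M').symm.toLinearMap))
    ∘ₗ (decomp Ω M).symm.toLinearMap

/-- The action of `U ⊗ U` on `M ⊗ M'`. -/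
def actTensor : U Ω ⊗[𝕜] U Ω →ₗ[𝕜] Module.End 𝕜 (M ⊗[𝕜] M') :=
  TensorProduct.homTensorHomMap (RingHom.id 𝕜) M M' M M' ∘ₗ
    TensorProduct.map (act Ω M).toLinearMap (act Ω M').toLinearMap

variable {Ω}

/-- The operator `Θ = ∑_{mu ∈ ℕ[I]} Θ_mu` on `M ⊗ M'`; the sum is finite on finite-dimensional
weight modules by `finite_support_theta` below. -/
def thetaOn (D : DualBases Ω) : Module.End 𝕜 (M ⊗[𝕜] M') :=
  ∑ᶠ mu : I → ℕ, actTensor Ω M M' (D.theta mu)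

/-- `𝓡_{M,M'} = Θ ∘ f̃ ∘ P : M ⊗ M' → M' ⊗ M`. -/
def rmat (D : DualBases Ω) [IsWeightModule Ω M] [IsWeightModule Ω M'] :
    M ⊗[𝕜] M' →ₗ[𝕜] M' ⊗[𝕜] M :=
  thetaOn M' M D ∘ₗ ftilde Ω M' M ∘ₗ (TensorProduct.comm 𝕜 M M').toLinearMap

variable (N : Type*) [AddCommGroup N] [Module 𝕜 N] [Module (U Ω) N] [IsScalarTower 𝕜 (U Ω) N]

/-- `𝓡₁₂ = 𝓡 ⊗ Id : M ⊗ M' ⊗ N → M' ⊗ M ⊗ N`. -/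
def rmat12 (D : DualBases Ω) [IsWeightModule Ω M] [IsWeightModule Ω M'] :
    (M ⊗[𝕜] M') ⊗[𝕜] N →ₗ[𝕜] (M' ⊗[𝕜] M) ⊗[𝕜] N :=
  (rmat M M' D).rTensor N

/-- `𝓡₂₃ = Id ⊗ 𝓡 : M ⊗ M' ⊗ N → M ⊗ N ⊗ M'`. -/
def rmat23 (D : DualBases Ω) [IsWeightModule Ω M'] [IsWeightModule Ω N] :
    (M ⊗[𝕜] M') ⊗[𝕜] N →ₗ[𝕜] (M ⊗[𝕜] N) ⊗[𝕜] M' :=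
  (TensorProduct.assoc 𝕜 M N M').symm.toLinearMap ∘ₗ (rmat M' N D).lTensor M ∘ₗ
    (TensorProduct.assoc 𝕜 M M' N).toLinearMap

end Modules

/-! ### Well-definedness of `f̃` and of `Θ` -/

section WellDefined

variable {Ω}
variable {M : Type*} [AddCommGroup M] [Module 𝕜 M] [Module (U Ω) M] [IsScalarTower 𝕜 (U Ω) M]
variable {M' : Type*} [AddCommGroup M'] [Module 𝕜 M'] [Module (U Ω) M']
  [IsScalarTower 𝕜 (U Ω) M']

theorem decomp_symm_apply [IsWeightModule Ω M] (lam : I → ℤ) (m : weightSpace Ω M lam) :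
    (decomp Ω M).symm m = DirectSum.lof 𝕜 (I → ℤ) (fun lam => weightSpace Ω M lam) lam m := by
  rw [LinearEquiv.symm_apply_eq]
  exact (DirectSum.coeLinearMap_lof (weightSpace Ω M) lam m).symm

theorem ftilde_tmul [IsWeightModule Ω M] [IsWeightModule Ω M'] (lam mu : I → ℤ)
    (m : M) (hm : m ∈ weightSpace Ω M lam) (m' : M') (hm' : m' ∈ weightSpace Ω M' mu) :
    ftilde Ω M M' (m ⊗ₜ m') = f Ω lam mu • (m ⊗ₜ m') := by
  have h1 := decomp_symm_apply lam ⟨m, hm⟩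
  have h2 := decomp_symm_apply mu ⟨m', hm'⟩
  simp only at h1 h2
  simp [ftilde, h1, h2]

theorem v_ne_zero : v ≠ 0 := fun h =>
  MvPolynomial.X_ne_zero (R := ℚ) (0 : Fin 2) <|
    IsFractionRing.injective (MvPolynomial (Fin 2) ℚ) (FractionRing (MvPolynomial (Fin 2) ℚ))
      (h.trans (map_zero (algebraMap (MvPolynomial (Fin 2) ℚ)
        (FractionRing (MvPolynomial (Fin 2) ℚ)))).symm)

theorem t_ne_zero : t ≠ 0 := fun h =>
  MvPolynomial.X_ne_zero (R := ℚ) (1 : Fin 2) <|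
    IsFractionRing.injective (MvPolynomial (Fin 2) ℚ) (FractionRing (MvPolynomial (Fin 2) ℚ))
      (h.trans (map_zero (algebraMap (MvPolynomial (Fin 2) ℚ)
        (FractionRing (MvPolynomial (Fin 2) ℚ)))).symm)

theorem gen_K_mul_gen_E (i j : I) : gen Ω (Gen.K i) * gen Ω (Gen.E j) =
    (v ^ (Ω i j + Ω j i) * t ^ (Ω j i - Ω i j)) • (gen Ω (Gen.E j) * gen Ω (Gen.K i)) := by
  have h : gen Ω (Gen.K i) * gen Ω (Gen.E j) * gen Ω (Gen.Ki i) =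
      (v ^ (Ω i j + Ω j i) * t ^ (Ω j i - Ω i j)) • gen Ω (Gen.E j) := by
    simpa only [gen, map_mul, map_smul] using mkU_rel Ω (Rel.K_E i j)
  have h' : gen Ω (Gen.Ki i) * gen Ω (Gen.K i) = 1 := by
    simpa only [gen, map_mul, map_one] using mkU_rel Ω (Rel.Ki_K i)
  rw [← smul_mul_assoc, ← h, mul_assoc _ (gen Ω (Gen.Ki i)), h', mul_one]

theorem gen_K'_mul_gen_E (i j : I) : gen Ω (Gen.K' i) * gen Ω (Gen.E j) =
    (v ^ (-(Ω i j + Ω j i)) * t ^ (Ω j i - Ω i j)) •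
      (gen Ω (Gen.E j) * gen Ω (Gen.K' i)) := by
  have h : gen Ω (Gen.K' i) * gen Ω (Gen.E j) * gen Ω (Gen.Ki' i) =
      (v ^ (-(Ω i j + Ω j i)) * t ^ (Ω j i - Ω i j)) • gen Ω (Gen.E j) := by
    simpa only [gen, map_mul, map_smul] using mkU_rel Ω (Rel.K'_E i j)
  have h' : gen Ω (Gen.Ki' i) * gen Ω (Gen.K' i) = 1 := by
    simpa only [gen, map_mul, map_one] using mkU_rel Ω (Rel.Ki'_K' i)
  rw [← smul_mul_assoc, ← h, mul_assoc _ (gen Ω (Gen.Ki' i)), h', mul_one]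

theorem ang_add_left (a b c : I → ℤ) : ang Ω (a + b) c = ang Ω a c + ang Ω b c := by
  simp [ang, add_mul, Finset.sum_add_distrib]

theorem ang_add_right (a b c : I → ℤ) : ang Ω a (b + c) = ang Ω a b + ang Ω a c := by
  simp [ang, mul_add, Finset.sum_add_distrib]

theorem ang_e_e (i j : I) : ang Ω (e i) (e j) = Ω i j := by
  simp [ang, e, Pi.single_apply]

/-- `E_j` maps `M_lam` to `M_{lam + j}`. -/
theorem gen_E_smul_mem (j : I) (lam : I → ℤ) (m : M) (hm : m ∈ weightSpace Ω M lam) :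
    gen Ω (Gen.E j) • m ∈ weightSpace Ω M (lam + e j) := by
  intro i
  obtain ⟨h1, h2⟩ := hm i
  have hv := v_ne_zero
  have ht := t_ne_zero
  have hE (c : 𝕜) : gen Ω (Gen.E j) • c • m = c • gen Ω (Gen.E j) • m := smul_comm _ _ _
  constructor
  · rw [smul_smul, gen_K_mul_gen_E, smul_assoc (_ * _ : 𝕜) (_ * _ : U Ω) m,
      mul_smul (gen Ω (Gen.E j)), h1, hE, smul_smul, mul_mul_mul_comm, cc, cc,
      ← zpow_add₀ hv, ← zpow_add₀ ht]
    simp only [dot, ang_add_left, ang_add_right, ang_e_e]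
    congr 3 <;> ring
  · rw [smul_smul, gen_K'_mul_gen_E, smul_assoc (_ * _ : 𝕜) (_ * _ : U Ω) m,
      mul_smul (gen Ω (Gen.E j)), h2, hE, smul_smul, mul_mul_mul_comm, cc, cc,
      ← zpow_add₀ hv, ← zpow_add₀ ht]
    simp only [dot, ang_add_left, ang_add_right, ang_e_e]
    congr 3 <;> ring

theorem word_smul_mem (w : List I) (lam : I → ℤ) (m : M) (hm : m ∈ weightSpace Ω M lam) :
    plus Ω (word w) • m ∈ weightSpace Ω M (lam + fun i => (w.count i : ℤ)) := by
  induction w with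
  | nil => simpa [word, show (fun _ : I => (0 : ℤ)) = 0 from rfl] using hm
  | cons j w ih =>
    have h1 : plus Ω (word (j :: w)) = gen Ω (Gen.E j) * plus Ω (word w) := by
      simp [word, plus]
    have h2 : (lam + fun i => ((j :: w).count i : ℤ)) =
        lam + (fun i => (w.count i : ℤ)) + e j := by
      ext i
      by_cases h : i = j
      · subst h; simp [e, add_assoc]
      · simp [List.count_cons_of_ne (Ne.symm h), e, h]
    rw [h1, h2, mul_smul]
    exact gen_E_smul_mem _ _ _ ih

/-- `x⁺` maps `M_lam` to `M_{lam + mu}` for `x ∈ 'f_mu`. -/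
theorem plus_smul_mem {mu : I → ℕ} {x : FF I} (hx : x ∈ homog mu) (lam : I → ℤ) (m : M)
    (hm : m ∈ weightSpace Ω M lam) :
    plus Ω x • m ∈ weightSpace Ω M (lam + fun i => (mu i : ℤ)) := by
  induction hx using Submodule.span_induction with
  | mem x hx =>
    obtain ⟨w, hw, rfl⟩ := hx
    simpa [hw] using word_smul_mem w lam m hm
  | zero => simp
  | add x y _ _ hx hy => rw [map_add, add_smul]; exact Submodule.add_mem _ hx hy
  | smul c x _ hx => rw [map_smul, smul_assoc]; exact Submodule.smul_mem _ _ hx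

/-- Only finitely many `Θ_mu` act nontrivially on `M ⊗ M'`. -/
theorem finite_support_theta (D : DualBases Ω) [FiniteDimensional 𝕜 M'] [IsWeightModule Ω M'] :
    (Function.support fun mu : I → ℕ => actTensor Ω M M' (D.theta mu)).Finite := by
  have hint := IsWeightModule.isInternal (Ω := Ω) (M := M')
  have hfin : {lam | weightSpace Ω M' lam ≠ ⊥}.Finite :=
    WellFoundedGT.finite_ne_bot_of_iSupIndep hint.submodule_iSupIndep
  have hinj : Function.Injective (fun (mu : I → ℕ) (i : I) => (mu i : ℤ)) := by
    intro a b h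
    ext i
    exact Int.ofNat.inj (congrFun h i)
  refine ((hfin.image2 (fun a b => a - b) hfin).preimage hinj.injOn).subset ?_
  intro mu hmu
  by_contra hcon
  apply hmu
  have hz : ∀ k, act Ω M' (plus Ω (D.bstar mu k)) = 0 := by
    intro k
    have htop : (⊤ : Submodule 𝕜 M') ≤ LinearMap.ker (act Ω M' (plus Ω (D.bstar mu k))) := by
      rw [← hint.submodule_iSup_eq_top]
      refine iSup_le fun lam m hm => ?_
      by_contra hne
      have hm' := plus_smul_mem (D.bstar_mem mu k) lam m hm
      refine hcon ⟨_, ?_, lam, ?_, add_sub_cancel_left lam _⟩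
      · intro hb
        rw [hb, Submodule.mem_bot] at hm'
        exact hne hm'
      · intro hb
        rw [hb, Submodule.mem_bot] at hm
        exact hne (by rw [hm]; exact zero_mem _)
    ext m
    exact htop trivial
  simp [actTensor, DualBases.theta, hz]

end WellDefined

end TwoParam

end

/-!
Both sides of the braid relation come from one computation. Write `r` for the operators
`Θ ∘ f̃ ∘ P`. The formula for `(Δ ⊗ 1)(Θ)` gives the hexagon identity: moving `M₁` past `M₂` and
then past `M₃` is the R-matrix of `M₁` and `M₂ ⊗ M₃`. The braid relation is the naturality of that
operator with respect to `r : M₂ ⊗ M₃ → M₃ ⊗ M₂`, that is, the fact that `r` commutes with the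
coproducts of the `F_i`.

On a finite-dimensional weight representation this needs only that dual bases reproduce the action
of `U⁺` and `U⁻` through the pairing, so that the radicals of the pairing on the free algebra `'f`
must act by zero. If `x ∈ 'f` of degree `mu` lies in the radical, then so do its skew derivatives,
and by induction the commutator formula
`[x⁺, F_i] = (v_i - v_i⁻¹)⁻¹ (derR x⁺ K_i - K'_i derL x⁺)` shows that `x⁺` commutes with all `F_i`.
The weights form a finite set stable under reflections, which carries a positive invariant form;
hence some `i` in the support of `mu` has positive coroot value on `mu`, or else `E_i = 0`. But by
`sl₂` theory an operator that commutes with `F_i` and raises `i`-weights vanishes.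
-/

noncomputable section

namespace TwoParam

/-! ### Scalars -/

section Brace

variable {I : Type u} [Fintype I] (Ω : I → I → ℤ)

theorem brace_ne_zero (a b : I → ℤ) : brace Ω a b ≠ 0 :=
  mul_ne_zero (zpow_ne_zero _ v_ne_zero) (zpow_ne_zero _ t_ne_zero)

theorem brace_add_left (a b c : I → ℤ) : brace Ω (a + b) c = brace Ω a c * brace Ω b c := by
  classical
  simp only [brace, dot, ang_add_left, ang_add_right]
  rw [mul_mul_mul_comm, ← zpow_add₀ v_ne_zero, ← zpow_add₀ t_ne_zero]
  congr 2 <;> ring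

theorem brace_add_right (a b c : I → ℤ) : brace Ω a (b + c) = brace Ω a b * brace Ω a c := by
  classical
  simp only [brace, dot, ang_add_left, ang_add_right]
  rw [mul_mul_mul_comm, ← zpow_add₀ v_ne_zero, ← zpow_add₀ t_ne_zero]
  congr 2 <;> ring

@[simp] theorem brace_zero_left (b : I → ℤ) : brace Ω 0 b = 1 := by
  simp [brace, dot, ang]

@[simp] theorem brace_zero_right (b : I → ℤ) : brace Ω b 0 = 1 := by
  simp [brace, dot, ang]

theorem brace_neg_left (a b : I → ℤ) : brace Ω (-a) b = (brace Ω a b)⁻¹ :=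
  eq_inv_of_mul_eq_one_left (by rw [← brace_add_left, neg_add_cancel, brace_zero_left])

theorem brace_neg_right (a b : I → ℤ) : brace Ω a (-b) = (brace Ω a b)⁻¹ :=
  eq_inv_of_mul_eq_one_left (by rw [← brace_add_right, neg_add_cancel, brace_zero_right])

theorem brace_sub_left (a b c : I → ℤ) : brace Ω (a - b) c = brace Ω a c * (brace Ω b c)⁻¹ := by
  rw [sub_eq_add_neg, brace_add_left, brace_neg_left]

theorem brace_sub_right (a b c : I → ℤ) : brace Ω a (b - c) = brace Ω a b * (brace Ω a c)⁻¹ := by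
  rw [sub_eq_add_neg, brace_add_right, brace_neg_right]

/-- The transposed matrix. It exchanges the two arguments of `⟨ , ⟩` and of `(x⁺, y⁻)_φ`, so that
statements about `U⁻` follow from statements about `U⁺`. -/
def transp {I : Type*} (Ω : I → I → ℤ) : I → I → ℤ := fun i j => Ω j i

theorem ang_transp (a b : I → ℤ) : ang (transp Ω) a b = ang Ω b a := by
  simp only [ang, transp]
  rw [Finset.sum_comm]
  exact Finset.sum_congr rfl fun i _ => Finset.sum_congr rfl fun j _ => by ring

theorem brace_transp (a b : I → ℤ) : brace (transp Ω) a b = brace Ω b a := by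
  simp only [brace, dot, ang_transp, add_comm]

/-- The character `lam ↦ {lam, mu}` of `ℤ[I]`. -/
def braceLeft (mu : I → ℤ) : AddChar (I → ℤ) 𝕜 where
  toFun lam := brace Ω lam mu
  map_zero_eq_one' := brace_zero_left Ω mu
  map_add_eq_mul' lam lam' := brace_add_left Ω lam lam' mu

/-- The character `mu ↦ {lam, mu}` of `ℤ[I]`. -/
def braceRight (lam : I → ℤ) : AddChar (I → ℤ) 𝕜 where
  toFun mu := brace Ω lam mu
  map_zero_eq_one' := brace_zero_right Ω lam
  map_add_eq_mul' mu mu' := brace_add_right Ω lam mu mu'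

@[simp] theorem braceLeft_apply (lam mu : I → ℤ) : braceLeft Ω mu lam = brace Ω lam mu := rfl

@[simp] theorem braceRight_apply (lam mu : I → ℤ) : braceRight Ω lam mu = brace Ω lam mu := rfl

end Brace

theorem v_pow_ne_one {n : ℕ} (hn : n ≠ 0) : v ^ n ≠ 1 := fun h => by
  have h1 : (MvPolynomial.X 0 : MvPolynomial (Fin 2) ℚ) ^ n = 1 :=
    IsFractionRing.injective (MvPolynomial (Fin 2) ℚ) (FractionRing (MvPolynomial (Fin 2) ℚ))
      (by rw [map_pow, map_one]; exact h)
  have h2 : (2 : ℚ) ^ n = 1 := by simpa using congrArg (MvPolynomial.eval fun _ => (2 : ℚ)) h1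
  exact (one_lt_pow₀ one_lt_two hn).ne' h2

theorem v_zpow_ne_one {n : ℤ} (hn : n ≠ 0) : v ^ n ≠ 1 := fun h => by
  rcases Int.natAbs_eq n with h' | h' <;> rw [h'] at h <;>
    exact v_pow_ne_one (Int.natAbs_ne_zero.2 hn) (by simpa only [zpow_neg, zpow_natCast,
      inv_eq_one] using h)

theorem vi_ne_zero {I : Type*} (Ω : I → I → ℤ) (i : I) : vi Ω i ≠ 0 := zpow_ne_zero _ v_ne_zero

theorem vi_zpow_ne_one {I : Type*} {Ω : I → I → ℤ} {i : I} (hi : Ω i i ≠ 0) {n : ℤ} (hn : n ≠ 0) :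
    vi Ω i ^ n ≠ 1 := by
  rw [vi, ← zpow_mul]
  exact v_zpow_ne_one (mul_ne_zero hi hn)

theorem vi_sub_inv_ne_zero {I : Type*} {Ω : I → I → ℤ} {i : I} (hi : Ω i i ≠ 0) :
    vi Ω i - (vi Ω i)⁻¹ ≠ 0 := fun h =>
  vi_zpow_ne_one hi two_ne_zero <| by
    rw [zpow_two, ← mul_inv_cancel₀ (vi_ne_zero Ω i), ← sub_eq_zero.1 h]

/-! ### The free algebra -/

/-- The inclusion `ℕ[I] ⊆ ℤ[I]`. -/
def toInt {I : Type*} (mu : I → ℕ) : I → ℤ := fun i => mu i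

section Words

variable {I : Type u}

@[simp] theorem toInt_zero : toInt (0 : I → ℕ) = 0 := by
  ext; simp [toInt]

theorem toInt_add (mu nu : I → ℕ) : toInt (mu + nu) = toInt mu + toInt nu := by
  ext; simp [toInt]

theorem toInt_injective : Function.Injective (toInt (I := I)) :=
  fun _ _ h => funext fun i => Int.ofNat.inj (congrFun h i)

@[simp] theorem word_nil : word ([] : List I) = 1 := rfl

theorem word_cons (i : I) (w : List I) : word (i :: w) = FreeAlgebra.ι 𝕜 i * word w := by
  simp [word]

theorem word_append (a b : List I) : word (a ++ b) = word a * word b := by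
  simp [word]

theorem span_range_word : Submodule.span 𝕜 (Set.range (word (I := I))) = ⊤ := by
  rw [eq_top_iff]
  rintro x -
  induction x using FreeAlgebra.induction with
  | grade0 r =>
    rw [Algebra.algebraMap_eq_smul_one]
    exact Submodule.smul_mem _ _ (Submodule.subset_span ⟨[], rfl⟩)
  | grade1 i => exact Submodule.subset_span ⟨[i], by simp [word]⟩
  | add x y hx hy => exact Submodule.add_mem _ hx hy
  | mul x y hx hy =>
    have h := Submodule.mul_mem_mul hx hy
    rw [Submodule.span_mul_span] at h
    refine Submodule.span_mono ?_ h
    rintro _ ⟨_, ⟨a, rfl⟩, _, ⟨b, rfl⟩, rfl⟩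
    exact ⟨a ++ b, word_append a b⟩

theorem linearMap_ext_word {N : Type*} [AddCommMonoid N] [Module 𝕜 N] {f g : FF I →ₗ[𝕜] N}
    (h : ∀ w, f (word w) = g (word w)) : f = g :=
  LinearMap.ext_on_range span_range_word h

theorem linearMap_ext_ι_mul {N : Type*} [AddCommMonoid N] [Module 𝕜 N] {f g : FF I →ₗ[𝕜] N}
    (one : f 1 = g 1)
    (ι_mul : ∀ i x, f x = g x → f (FreeAlgebra.ι 𝕜 i * x) = g (FreeAlgebra.ι 𝕜 i * x)) :
    f = g :=
  linearMap_ext_word fun w => by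
    induction w with
    | nil => exact one
    | cons i w ih => rw [word_cons]; exact ι_mul i _ ih

variable [DecidableEq I]

theorem toInt_single (i : I) : toInt (Pi.single i 1) = e i := by
  ext k
  by_cases h : k = i
  · subst h; simp [toInt, e]
  · simp [toInt, e, h]

theorem single_one_le {mu : I → ℕ} {i : I} (hi : 0 < mu i) : Pi.single i 1 ≤ mu :=
  update_le_iff.2 ⟨hi, fun _ _ => Nat.zero_le _⟩

theorem count_cons_eq (i : I) (w : List I) :
    (fun k => (i :: w).count k) = (fun k => w.count k) + Pi.single i 1 := by
  ext k
  by_cases h : k = i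
  · subst h; simp
  · simp [h, List.count_cons_of_ne (Ne.symm h)]

theorem word_mem_homog (w : List I) : word w ∈ homog (fun i => w.count i) :=
  Submodule.subset_span ⟨w, fun _ => rfl, rfl⟩

theorem homog_le_of_word_mem {mu : I → ℕ} {S : Submodule 𝕜 (FF I)}
    (h : ∀ w : List I, (fun i => w.count i) = mu → word w ∈ S) : homog mu ≤ S :=
  Submodule.span_le.2 fun _ ⟨w, hw, hx⟩ => hx ▸ h w (funext hw)

theorem ι_mul_mem_homog (j : I) {mu : I → ℕ} {x : FF I} (hx : x ∈ homog mu) :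
    FreeAlgebra.ι 𝕜 j * x ∈ homog (mu + Pi.single j 1) := by
  suffices h : homog mu ≤
      (homog (mu + Pi.single j 1)).comap (LinearMap.mulLeft 𝕜 (FreeAlgebra.ι 𝕜 j)) from h hx
  refine homog_le_of_word_mem fun w hw => ?_
  have := word_mem_homog (j :: w)
  rwa [count_cons_eq, hw, word_cons] at this

end Words

/-! ### Twists and skew derivations of the free algebra -/

section SkewDerivations

variable {I : Type u} [DecidableEq I] (χ ψ φ : AddChar (I → ℤ) 𝕜)

/-- The action of a character `χ` of `ℤ[I]` on `'f`, namely multiplication by `χ mu` in degree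
`mu`. -/
def twist : FF I →ₐ[𝕜] FF I := FreeAlgebra.lift 𝕜 fun j => χ (e j) • FreeAlgebra.ι 𝕜 j

@[simp] theorem twist_ι (j : I) :
    twist χ (FreeAlgebra.ι 𝕜 j) = χ (e j) • FreeAlgebra.ι 𝕜 j := by
  simp [twist]

@[simp] theorem twist_one : twist (1 : AddChar (I → ℤ) 𝕜) = AlgHom.id 𝕜 (FF I) := by
  ext; simp

theorem twist_comm (x : FF I) : twist χ (twist ψ x) = twist ψ (twist χ x) := by
  suffices h : (twist χ).comp (twist ψ) = (twist ψ).comp (twist χ) from DFunLike.congr_fun h x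
  ext; simp [smul_smul, mul_comm]

theorem twist_of_mem_homog {mu : I → ℕ} {x : FF I} (hx : x ∈ homog mu) :
    twist χ x = χ (toInt mu) • x := by
  have hword (w : List I) : twist χ (word w) = χ (toInt fun i => w.count i) • word w := by
    induction w with
    | nil => simp [show (fun _ : I => 0) = (0 : I → ℕ) from rfl]
    | cons j w ih =>
      rw [count_cons_eq, toInt_add, toInt_single, AddChar.map_add_eq_mul, word_cons, map_mul, ih,
        twist_ι, smul_mul_smul_comm, mul_comm]
  suffices h : homog mu ≤
      LinearMap.eqLocus (twist χ).toLinearMap (χ (toInt mu) • LinearMap.id) from h hx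
  exact homog_le_of_word_mem fun w hw => by simpa [hw] using hword w

/-- The homomorphism `x ↦ !![twist χ x, skewDer χ ψ i x; 0, twist ψ x]`; its multiplicativity is
the twisted Leibniz rule. -/
def skewDerMat (i : I) : FF I →ₐ[𝕜] Matrix (Fin 2) (Fin 2) (FF I) :=
  FreeAlgebra.lift 𝕜 fun j =>
    !![χ (e j) • FreeAlgebra.ι 𝕜 j, if j = i then 1 else 0; 0, ψ (e j) • FreeAlgebra.ι 𝕜 j]

/-- The skew derivation of `'f` with `θ_j ↦ δ_ij` and
`x y ↦ twist χ x * skewDer χ ψ i y + skewDer χ ψ i x * twist ψ y`. -/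
def skewDer (i : I) : FF I →ₗ[𝕜] FF I :=
  Matrix.entryLinearMap 𝕜 (FF I) 0 1 ∘ₗ (skewDerMat χ ψ i).toLinearMap

theorem skewDerMat_apply (i : I) (x : FF I) :
    skewDerMat χ ψ i x = !![twist χ x, skewDer χ ψ i x; 0, twist ψ x] := by
  have h : skewDerMat χ ψ i x 0 0 = twist χ x ∧ skewDerMat χ ψ i x 1 0 = 0 ∧
      skewDerMat χ ψ i x 1 1 = twist ψ x := by
    induction x using FreeAlgebra.induction with
    | grade0 r => simp [Algebra.algebraMap_eq_smul_one]
    | grade1 j => simp [skewDerMat]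
    | add x y hx hy => simp [hx, hy]
    | mul x y hx hy => simp [Matrix.mul_apply, Fin.sum_univ_two, hx, hy]
  ext a b
  fin_cases a <;> fin_cases b <;> simp [skewDer, h]

theorem skewDer_mul (i : I) (x y : FF I) : skewDer χ ψ i (x * y) =
    twist χ x * skewDer χ ψ i y + skewDer χ ψ i x * twist ψ y := by
  have h := congrFun₂ (map_mul (skewDerMat χ ψ i) x y) 0 1
  simpa [skewDerMat_apply] using h

@[simp] theorem skewDer_one (i : I) : skewDer χ ψ i 1 = 0 := by simp [skewDer]

@[simp] theorem skewDer_ι (i j : I) :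
    skewDer χ ψ i (FreeAlgebra.ι 𝕜 j) = if j = i then 1 else 0 := by
  simp [skewDer, skewDerMat]

theorem skewDer_ι_mul (i j : I) (x : FF I) : skewDer χ ψ i (FreeAlgebra.ι 𝕜 j * x) =
    χ (e j) • (FreeAlgebra.ι 𝕜 j * skewDer χ ψ i x) + if j = i then twist ψ x else 0 := by
  simp [skewDer_mul]

theorem skewDer_twist (i : I) (x : FF I) :
    skewDer χ ψ i (twist φ x) = φ (e i) • twist φ (skewDer χ ψ i x) := by
  suffices h : skewDer χ ψ i ∘ₗ (twist φ).toLinearMap =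
      φ (e i) • ((twist φ).toLinearMap ∘ₗ skewDer χ ψ i) from LinearMap.congr_fun h x
  refine linearMap_ext_ι_mul (by simp) fun k x hx => ?_
  simp only [LinearMap.comp_apply, AlgHom.toLinearMap_apply, LinearMap.smul_apply] at hx ⊢
  rw [map_mul, twist_ι, smul_mul_assoc, map_smul, skewDer_ι_mul, hx, skewDer_ι_mul]
  by_cases hk : k = i
  · subst hk
    simp [smul_smul, twist_comm ψ]
  · simp [hk, smul_smul, mul_comm, mul_left_comm]

theorem skewDer_comm {i j : I} (h : ψ (e j) = χ (e i)) (x : FF I) :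
    skewDer χ 1 j (skewDer 1 ψ i x) = skewDer 1 ψ i (skewDer χ 1 j x) := by
  suffices hcomp : skewDer χ 1 j ∘ₗ skewDer 1 ψ i = skewDer 1 ψ i ∘ₗ skewDer χ 1 j from
    LinearMap.congr_fun hcomp x
  refine linearMap_ext_ι_mul (by simp) fun k x hx => ?_
  simp only [LinearMap.comp_apply, skewDer_ι_mul, map_add, map_smul, AddChar.one_apply, one_smul,
    twist_one, AlgHom.id_apply] at hx ⊢
  by_cases hi : k = i
  · by_cases hj : k = j
    · subst hi; subst hj; simp only [if_true, skewDer_twist, hx, h, smul_add]; abel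
    · subst hi; simp [hj, skewDer_twist, hx, h]
  · by_cases hj : k = j
    · subst hj; simp [hi, hx]
    · simp [hi, hj, hx]

theorem skewDer_eq_zero_of_mem_homog {mu : I → ℕ} {i : I} (hi : mu i = 0) {x : FF I}
    (hx : x ∈ homog mu) : skewDer χ ψ i x = 0 := by
  suffices h : homog mu ≤ LinearMap.ker (skewDer χ ψ i) from h hx
  refine homog_le_of_word_mem fun w hw => ?_
  have hiw : i ∉ w := List.count_eq_zero.1 ((congrFun hw i).trans hi)
  clear hw
  rw [LinearMap.mem_ker]
  induction w with
  | nil => simp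
  | cons j w ih =>
    rw [List.mem_cons, not_or] at hiw
    simp [word_cons, skewDer_ι_mul, ih hiw.2, Ne.symm hiw.1]

theorem skewDer_mem_homog {mu : I → ℕ} (i : I) {x : FF I}
    (hx : x ∈ homog (mu + Pi.single i 1)) : skewDer χ ψ i x ∈ homog mu := by
  suffices h : homog (mu + Pi.single i 1) ≤ (homog mu).comap (skewDer χ ψ i) from h hx
  refine homog_le_of_word_mem fun w hw => ?_
  rw [Submodule.mem_comap]
  clear hx
  induction w generalizing mu with
  | nil => simp
  | cons j w ih =>
    rw [count_cons_eq] at hw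
    rw [word_cons, skewDer_ι_mul]
    refine add_mem (Submodule.smul_mem _ _ ?_) ?_
    · rcases Nat.eq_zero_or_pos (w.count i) with hi | hi
      · rw [skewDer_eq_zero_of_mem_homog χ ψ hi (word_mem_homog w), mul_zero]
        exact zero_mem _
      · have hw' := tsub_add_cancel_of_le (single_one_le (mu := fun k => w.count k) hi)
        rw [← hw', add_right_comm, add_left_inj] at hw
        exact hw ▸ ι_mul_mem_homog j (ih hw'.symm)
    · split_ifs with hj
      · subst hj
        rw [← add_right_cancel hw, twist_of_mem_homog ψ (word_mem_homog w)]
        exact Submodule.smul_mem _ _ (word_mem_homog w)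
      · exact zero_mem _

/-- The augmentation of `'f`. -/
def aug : FF I →ₐ[𝕜] 𝕜 := FreeAlgebra.lift 𝕜 fun _ => 0

omit [DecidableEq I] in
@[simp] theorem aug_ι (i : I) : aug (FreeAlgebra.ι 𝕜 i) = 0 := by simp [aug]

@[simp] theorem aug_twist (x : FF I) : aug (twist χ x) = aug x := by
  have : aug.comp (twist χ) = aug := by ext; simp
  exact DFunLike.congr_fun this x

theorem aug_skewDer_eq (χ' ψ' : AddChar (I → ℤ) 𝕜) (i : I) (x : FF I) :
    aug (skewDer χ ψ i x) = aug (skewDer χ' ψ' i x) := by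
  suffices h : aug.toLinearMap ∘ₗ skewDer χ ψ i = aug.toLinearMap ∘ₗ skewDer χ' ψ' i from
    LinearMap.congr_fun h x
  refine linearMap_ext_ι_mul (by simp) fun j x _ => ?_
  simp [skewDer_ι_mul, apply_ite (aug (I := I))]

end SkewDerivations

/-! ### The pairing -/

section Pairing

variable {I : Type u}

theorem counitPos_comulPos (z : Borel I) :
    TensorProduct.lid 𝕜 (Borel I) (counitPos.toLinearMap.rTensor (Borel I) (comulPos z)) = z := by
  suffices h : (Algebra.TensorProduct.lid 𝕜 (Borel I)).toAlgHom.comp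
      ((Algebra.TensorProduct.map counitPos (AlgHom.id 𝕜 (Borel I))).comp comulPos) =
      AlgHom.id 𝕜 (Borel I) from DFunLike.congr_fun h z
  ext j
  cases j <;> simp [comulPos, counitPos]

theorem bilin_ext_ι_mul_right {f g : FF I →ₗ[𝕜] FF I →ₗ[𝕜] 𝕜} (one : ∀ x, f x 1 = g x 1)
    (ι_mul : ∀ i y, (∀ x, f x y = g x y) →
      ∀ x, f x (FreeAlgebra.ι 𝕜 i * y) = g x (FreeAlgebra.ι 𝕜 i * y)) (x y : FF I) :
    f x y = g x y := by
  suffices h : f.flip = g.flip from LinearMap.congr_fun₂ h y x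
  exact linearMap_ext_ι_mul (LinearMap.ext one) fun i y hy =>
    LinearMap.ext (ι_mul i y (LinearMap.congr_fun hy))

theorem toBorel_ι (i : I) :
    toBorel (FreeAlgebra.ι 𝕜 i) = FreeAlgebra.ι 𝕜 (BGen.x i) := by
  simp [toBorel]

variable [Fintype I] [DecidableEq I] (Ω : I → I → ℤ)

/-- The left skew derivation of Lusztig, with `derL (x y) = (twist x) * derL y + derL x * y`. -/
def derL (i : I) : FF I →ₗ[𝕜] FF I := skewDer (braceLeft Ω (e i)) 1 i

/-- The right skew derivation of Lusztig, with `derR (x y) = x * derR y + derR x * (twist y)`. -/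
def derR (i : I) : FF I →ₗ[𝕜] FF I := skewDer 1 (braceRight Ω (e i)) i

theorem derL_mul (i : I) (x y : FF I) :
    derL Ω i (x * y) = twist (braceLeft Ω (e i)) x * derL Ω i y + derL Ω i x * y := by
  simp [derL, skewDer_mul]

theorem derL_ι_mul (i j : I) (x : FF I) : derL Ω i (FreeAlgebra.ι 𝕜 j * x) =
    brace Ω (e j) (e i) • (FreeAlgebra.ι 𝕜 j * derL Ω i x) + if j = i then x else 0 := by
  simp [derL, skewDer_ι_mul]

theorem derR_ι_mul (i j : I) (x : FF I) : derR Ω i (FreeAlgebra.ι 𝕜 j * x) =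
    FreeAlgebra.ι 𝕜 j * derR Ω i x +
      if j = i then twist (braceRight Ω (e i)) x else 0 := by
  simp [derR, skewDer_ι_mul]

theorem derL_derR (i j : I) (x : FF I) : derL Ω j (derR Ω i x) = derR Ω i (derL Ω j x) :=
  skewDer_comm _ _ (by simp) x

/-- `(E_i, F_i)_φ`. -/
def pairC (i : I) : 𝕜 := ((vi Ω i)⁻¹ - vi Ω i)⁻¹

theorem pairGen_lower (i : I) (z : Borel I) :
    pairGen Ω i z 1 0 = 0 ∧ pairGen Ω i z 1 1 = counitPos z := by
  induction z using FreeAlgebra.induction with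
  | grade0 r => simp [Algebra.algebraMap_eq_smul_one]
  | grade1 j => cases j <;> simp [pairGen, counitPos]
  | add x y hx hy => simp [hx, hy]
  | mul x y hx hy => simp [Matrix.mul_apply, Fin.sum_univ_two, hx, hy]

theorem pairFun_x_mul (i : I) (x z : Borel I) : pairFun Ω (.x i) (x * z) =
    pairFun Ω (.k i) x * pairFun Ω (.x i) z + pairFun Ω (.x i) x * counitPos z := by
  simp [pairFun, Matrix.mul_apply, Fin.sum_univ_two, pairGen_lower]

theorem contract_x_mul (i j : I) (z : Borel I) :
    contract (pairFun Ω (.x i)) (FreeAlgebra.ι 𝕜 (.x j) * z) =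
      brace Ω (e j) (e i) • (FreeAlgebra.ι 𝕜 (.x j) * contract (pairFun Ω (.x i)) z) +
      if j = i then pairC Ω i • z else 0 := by
  have hx (a : Borel I) : pairFun Ω (.x i) (FreeAlgebra.ι 𝕜 (.x j) * a) =
      if j = i then pairC Ω i * counitPos a else 0 := by
    rw [pairFun_x_mul]
    by_cases hji : j = i
    · subst hji; simp [pairFun, pairGen, pairC]
    · simp [pairFun, pairGen, hji]
  have hk (a : Borel I) : pairFun Ω (.x i) (FreeAlgebra.ι 𝕜 (.k j) * a) =
      brace Ω (e j) (e i) * pairFun Ω (.x i) a := by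
    rw [pairFun_x_mul]; simp [pairFun, pairGen]
  have hc : comulPos (FreeAlgebra.ι 𝕜 (BGen.x j)) = FreeAlgebra.ι 𝕜 (.x j) ⊗ₜ[𝕜] 1 +
      FreeAlgebra.ι 𝕜 (.k j) ⊗ₜ[𝕜] FreeAlgebra.ι 𝕜 (.x j) := by
    simp [comulPos]
  let slice (φ : Borel I →ₗ[𝕜] 𝕜) : Borel I ⊗[𝕜] Borel I →ₗ[𝕜] Borel I :=
    (TensorProduct.lid 𝕜 (Borel I)).toLinearMap ∘ₗ φ.rTensor (Borel I)
  have key : slice (pairFun Ω (.x i)) ∘ₗ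
        LinearMap.mulLeft 𝕜 (comulPos (FreeAlgebra.ι 𝕜 (.x j))) =
      brace Ω (e j) (e i) • (LinearMap.mulLeft 𝕜 (FreeAlgebra.ι 𝕜 (.x j)) ∘ₗ
        slice (pairFun Ω (.x i))) +
      if j = i then pairC Ω i • slice counitPos.toLinearMap else 0 := by
    refine TensorProduct.ext' fun a b => ?_
    simp only [slice, LinearMap.comp_apply, LinearMap.mulLeft_apply, hc, add_mul,
      Algebra.TensorProduct.tmul_mul_tmul, one_mul, map_add, LinearMap.rTensor_tmul, hx, hk]
    split_ifs <;> simp [smul_smul, add_comm]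
  have h := LinearMap.congr_fun key (comulPos z)
  split_ifs at h ⊢ <;>
    simpa [slice, contract, counitPos_comulPos] using h

theorem contract_toBorel (i : I) (x : FF I) :
    contract (pairFun Ω (.x i)) (toBorel x) = pairC Ω i • toBorel (derL Ω i x) := by
  suffices h : contract (pairFun Ω (.x i)) ∘ₗ toBorel.toLinearMap =
      pairC Ω i • (toBorel.toLinearMap ∘ₗ derL Ω i) from LinearMap.congr_fun h x
  refine linearMap_ext_ι_mul ?_ fun j x hx => ?_
  · simp [contract, pairFun, derL, Algebra.TensorProduct.one_def]
  · simp only [LinearMap.comp_apply, AlgHom.toLinearMap_apply, LinearMap.smul_apply] at hx ⊢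
    rw [map_mul, toBorel_ι, contract_x_mul, hx, derL_ι_mul, map_add, map_smul, map_mul, toBorel_ι]
    split_ifs <;> simp [smul_smul, mul_comm]

theorem pair_one_right (x : FF I) : pair Ω x 1 = aug x := by
  have h : (counitPos.comp toBorel : FF I →ₐ[𝕜] 𝕜) = aug := by
    ext i; simp [toBorel_ι, counitPos]
  simp [pair, pairing, ← h]

theorem pair_ι_mul_right (i : I) (x y : FF I) :
    pair Ω x (FreeAlgebra.ι 𝕜 i * y) = pairC Ω i * pair Ω (derL Ω i x) y := by
  have h : contractHom Ω (FreeAlgebra.ι 𝕜 (BGen.x i)) =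
      MulOpposite.op (contract (pairFun Ω (.x i))) := by simp [contractHom]
  simp [pair, pairing, toBorel_ι, h, contract_toBorel]

theorem pair_mul_ι_right (i : I) (x y : FF I) :
    pair Ω x (y * FreeAlgebra.ι 𝕜 i) = pairC Ω i * pair Ω (derR Ω i x) y := by
  refine bilin_ext_ι_mul_right (f := (pair Ω).compl₂ (LinearMap.mulRight 𝕜 (FreeAlgebra.ι 𝕜 i)))
    (g := pairC Ω i • (pair Ω ∘ₗ derR Ω i)) (fun x => ?_) (fun j y hy x => ?_) x y
  · have := pair_ι_mul_right Ω i x 1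
    rw [mul_one, pair_one_right] at this
    simp [this, pair_one_right, derL, derR, aug_skewDer_eq _ _ 1 (braceRight Ω (e i))]
  · simp only [LinearMap.compl₂_apply, LinearMap.mulRight_apply, LinearMap.smul_apply,
      LinearMap.comp_apply, smul_eq_mul] at hy ⊢
    rw [mul_assoc, pair_ι_mul_right, hy, pair_ι_mul_right, derL_derR]
    ring

theorem pair_one_left (y : FF I) : pair Ω 1 y = aug y := by
  suffices h : pair Ω 1 = aug.toLinearMap from LinearMap.congr_fun h y
  exact linearMap_ext_ι_mul (by simp [pair_one_right]) fun i y _ => by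
    simp [pair_ι_mul_right, derL]

theorem pair_ι_mul_left (i : I) (x y : FF I) :
    pair Ω (FreeAlgebra.ι 𝕜 i * x) y = pairC Ω i * pair Ω x (derL (transp Ω) i y) := by
  refine bilin_ext_ι_mul_right (f := pair Ω ∘ₗ LinearMap.mulLeft 𝕜 (FreeAlgebra.ι 𝕜 i))
    (g := pairC Ω i • (pair Ω).compl₂ (derL (transp Ω) i)) (fun x => ?_) (fun j y hy x => ?_) x y
  · simp [pair_one_right, derL]
  · simp only [LinearMap.comp_apply, LinearMap.mulLeft_apply, LinearMap.smul_apply,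
      LinearMap.compl₂_apply, smul_eq_mul] at hy ⊢
    rw [pair_ι_mul_right, derL_ι_mul, derL_ι_mul, brace_transp, map_add, map_smul, map_add,
      map_smul, LinearMap.add_apply, LinearMap.smul_apply, hy, pair_ι_mul_right]
    by_cases hij : i = j
    · subst hij
      simp only [if_true, smul_eq_mul]
    · simp only [if_neg hij, if_neg (Ne.symm hij), smul_eq_mul, map_zero, LinearMap.zero_apply]
      ring

theorem pair_transp (x y : FF I) : pair (transp Ω) y x = pair Ω x y := by
  suffices h : (pair (transp Ω)).flip = pair Ω from LinearMap.congr_fun₂ h x y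
  refine linearMap_ext_ι_mul ?_ fun i x hx => ?_ <;> ext1 y
  · simp [pair_one_right, pair_one_left]
  · have hx' := LinearMap.congr_fun hx (derL (transp Ω) i y)
    rw [LinearMap.flip_apply] at hx' ⊢
    rw [pair_ι_mul_right, hx', pair_ι_mul_left]
    rfl

theorem pair_twist_left (χ : AddChar (I → ℤ) 𝕜) (x y : FF I) :
    pair Ω (twist χ x) y = pair Ω x (twist χ y) := by
  refine bilin_ext_ι_mul_right (f := pair Ω ∘ₗ (twist χ).toLinearMap)
    (g := (pair Ω).compl₂ (twist χ).toLinearMap) (fun x => ?_) (fun i y hy x => ?_) x y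
  · simp [pair_one_right]
  · simp only [LinearMap.comp_apply, AlgHom.toLinearMap_apply, LinearMap.compl₂_apply] at hy ⊢
    rw [map_mul (twist χ), twist_ι, smul_mul_assoc, map_smul, pair_ι_mul_right, pair_ι_mul_right,
      ← hy, derL, skewDer_twist, map_smul, LinearMap.smul_apply, smul_eq_mul, smul_eq_mul]
    ring

theorem pair_homog_eq_zero {mu nu : I → ℕ} (h : mu ≠ nu) {x y : FF I} (hx : x ∈ homog mu)
    (hy : y ∈ homog nu) : pair Ω x y = 0 := by
  obtain ⟨k, hk⟩ := Function.ne_iff.1 h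
  let χ : AddChar (I → ℤ) 𝕜 :=
    { toFun lam := v ^ lam k
      map_zero_eq_one' := zpow_zero v
      map_add_eq_mul' lam lam' := zpow_add₀ v_ne_zero (lam k) (lam' k) }
  have htwist : v ^ (mu k : ℤ) * pair Ω x y = v ^ (nu k : ℤ) * pair Ω x y := by
    have := pair_twist_left Ω χ x y
    rwa [twist_of_mem_homog χ hx, twist_of_mem_homog χ hy, map_smul, map_smul] at this
  by_contra hne
  refine v_zpow_ne_one (n := (mu k : ℤ) - nu k) (by omega) ?_
  rw [zpow_sub₀ v_ne_zero, mul_right_cancel₀ hne htwist, div_self (zpow_ne_zero _ v_ne_zero)]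

end Pairing

section TwistedComul

variable {I : Type u} [Fintype I] [DecidableEq I] (Ω : I → I → ℤ)

/-- The homomorphism that sends `θ_i` to left multiplication by `r(θ_i)` in Lusztig's twisted tensor
square of `'f`. -/
def twistedComulHom : FF I →ₐ[𝕜] Module.End 𝕜 (FF I ⊗[𝕜] FF I) :=
  FreeAlgebra.lift 𝕜 fun i =>
    (LinearMap.mulLeft 𝕜 (FreeAlgebra.ι 𝕜 i)).rTensor (FF I) +
      TensorProduct.map (twist (braceLeft Ω (e i))).toLinearMap
        (LinearMap.mulLeft 𝕜 (FreeAlgebra.ι 𝕜 i))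

/-- Lusztig's twisted coproduct `r : 'f → 'f ⊗ 'f`, the adjoint of the product under the pairing. -/
def twistedComul : FF I →ₗ[𝕜] FF I ⊗[𝕜] FF I :=
  (LinearMap.applyₗ (1 ⊗ₜ 1)) ∘ₗ (twistedComulHom Ω).toLinearMap

@[simp] theorem twistedComul_one : twistedComul Ω 1 = 1 ⊗ₜ 1 := by simp [twistedComul]

theorem twistedComul_ι_mul (i : I) (y : FF I) : twistedComul Ω (FreeAlgebra.ι 𝕜 i * y) =
    (LinearMap.mulLeft 𝕜 (FreeAlgebra.ι 𝕜 i)).rTensor (FF I) (twistedComul Ω y) +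
      TensorProduct.map (twist (braceLeft Ω (e i))).toLinearMap
        (LinearMap.mulLeft 𝕜 (FreeAlgebra.ι 𝕜 i)) (twistedComul Ω y) := by
  simp [twistedComul, twistedComulHom]

theorem pair_mul_left (x x' y : FF I) : pair Ω (x * x') y =
    LinearMap.mul' 𝕜 𝕜 (TensorProduct.map (pair Ω x) (pair Ω x') (twistedComul Ω y)) := by
  suffices h : pair Ω (x * x') =
      LinearMap.mul' 𝕜 𝕜 ∘ₗ TensorProduct.map (pair Ω x) (pair Ω x') ∘ₗ twistedComul Ω from
    LinearMap.congr_fun h y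
  refine linearMap_ext_word fun w => ?_
  simp only [LinearMap.comp_apply]
  induction w generalizing x x' with
  | nil => simp [pair_one_right]
  | cons i w ih =>
    have hι (z : FF I) : pair Ω z ∘ₗ LinearMap.mulLeft 𝕜 (FreeAlgebra.ι 𝕜 i) =
        pairC Ω i • pair Ω (derL Ω i z) := LinearMap.ext (pair_ι_mul_right Ω i z)
    have htwist : pair Ω x ∘ₗ (twist (braceLeft Ω (e i))).toLinearMap =
        pair Ω (twist (braceLeft Ω (e i)) x) :=
      LinearMap.ext fun y => (pair_twist_left Ω _ x y).symm
    rw [word_cons, pair_ι_mul_right, derL_mul, twistedComul_ι_mul, map_add, map_add,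
      LinearMap.rTensor, ← LinearMap.comp_apply (TensorProduct.map _ _),
      ← LinearMap.comp_apply (TensorProduct.map _ _), ← TensorProduct.map_comp,
      ← TensorProduct.map_comp, LinearMap.comp_id, hι, hι, htwist, TensorProduct.map_smul_left,
      TensorProduct.map_smul_right, map_add, LinearMap.add_apply, ih, ih]
    simp only [LinearMap.smul_apply, map_smul, smul_eq_mul]
    ring

end TwistedComul

/-! ### Finite sets of weights stable under reflections -/

section Reflections

variable {V P ι : Type*} [AddCommGroup V] {wt : P → V} {root : ι → V}
  {coroot : ι → V →+ ℤ} {s : ι → Equiv.Perm P}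

theorem two_mul_sum_coroot_mul [Fintype P] {i : ι} (h2 : coroot i (root i) = 2)
    (hs : ∀ ρ, wt (s i ρ) = wt ρ - coroot i (wt ρ) • root i) (η : V →+ ℚ) :
    2 * ∑ ρ, (coroot i (wt ρ) : ℚ) * η (wt ρ) =
      η (root i) * ∑ ρ, (coroot i (wt ρ) : ℚ) * coroot i (wt ρ) := by
  have h : ∑ ρ, (coroot i (wt ρ) : ℚ) * η (wt ρ) =
      ∑ ρ, (-(coroot i (wt ρ) * η (wt ρ)) +
        η (root i) * ((coroot i (wt ρ) : ℚ) * coroot i (wt ρ))) := by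
    rw [← Equiv.sum_comp (s i)]
    refine Finset.sum_congr rfl fun ρ _ => ?_
    simp only [hs, map_sub, map_zsmul, h2, smul_eq_mul, zsmul_eq_mul]
    push_cast
    ring
  rw [Finset.sum_add_distrib, Finset.sum_neg_distrib, ← Finset.mul_sum] at h
  linarith

theorem exists_coroot_pos_of_finite_reflections [Finite P] (h2 : ∀ i, coroot i (root i) = 2)
    (hs : ∀ i ρ, wt (s i ρ) = wt ρ - coroot i (wt ρ) • root i) {J : Finset ι}
    (hwt : ∀ i ∈ J, ∃ ρ, coroot i (wt ρ) ≠ 0) {c : ι → ℕ} {η : V →+ ℚ}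
    (hη : η (∑ i ∈ J, c i • root i) ≠ 0) :
    ∃ i ∈ J, 0 < coroot i (∑ j ∈ J, c j • root j) := by
  cases nonempty_fintype P
  by_contra! hle
  set β := ∑ i ∈ J, c i • root i with hβ
  let d (i : ι) : ℚ := ∑ ρ, (coroot i (wt ρ) : ℚ) * coroot i (wt ρ)
  have hd (i : ι) (hi : i ∈ J) : 0 < d i := by
    obtain ⟨ρ, hρ⟩ := hwt i hi
    exact Finset.sum_pos' (fun _ _ => mul_self_nonneg _)
      ⟨ρ, Finset.mem_univ ρ, mul_self_pos.2 (Int.cast_ne_zero.2 hρ)⟩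
  -- `u` represents `β` for the invariant form `B(ξ, η) = ∑ ρ, ξ (wt ρ) * η (wt ρ)`.
  let u : V →+ ℚ := ∑ i ∈ J, (AddMonoidHom.mulLeft (2 * c i / d i)).comp
    ((Int.castAddHom ℚ).comp (coroot i))
  have hu (x : V) : u x = ∑ i ∈ J, 2 * c i / d i * coroot i x := by
    simp [u, AddMonoidHom.finsetSum_apply]
  have hBu (ξ : V →+ ℚ) : ∑ ρ, u (wt ρ) * ξ (wt ρ) = ξ β := by
    simp only [hu, hβ, map_sum, map_nsmul, Finset.sum_mul]
    rw [Finset.sum_comm]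
    refine Finset.sum_congr rfl fun i hi => ?_
    have hB : 2 * ∑ ρ, (coroot i (wt ρ) : ℚ) * ξ (wt ρ) = ξ (root i) * d i :=
      two_mul_sum_coroot_mul (h2 i) (hs i) ξ
    simp only [mul_assoc, ← Finset.mul_sum, nsmul_eq_mul]
    rw [mul_comm_div, mul_assoc, mul_left_comm, ← mul_div_assoc, hB,
      mul_div_cancel_right₀ _ (hd i hi).ne']
  have huβ : u β ≤ 0 := by
    rw [hu]
    refine Finset.sum_nonpos fun i hi => mul_nonpos_of_nonneg_of_nonpos ?_ ?_
    · have := hd i hi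
      positivity
    · exact_mod_cast hle i hi
  have hu0 (ρ : P) : u (wt ρ) = 0 := by
    rw [← hBu] at huβ
    have hsum := le_antisymm huβ (Finset.sum_nonneg fun ρ _ => mul_self_nonneg _)
    exact mul_self_eq_zero.1 <|
      (Finset.sum_eq_zero_iff_of_nonneg fun ρ _ => mul_self_nonneg _).1 hsum ρ (Finset.mem_univ ρ)
  exact hη (by simp [← hBu η, hu0])

end Reflections

/-! ### Strings for `sl₂` -/

section Strings

variable {k M : Type*} [Field k] [AddCommGroup M] [Module k M] {E F : Module.End k M}
  {W : ℤ → Submodule k M} {φ : ℤ → k} {a N : ℤ}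

/-- The Casimir operator acts on a vector `m` of degree `j` with `F (E m) = (φ p - φ j) • m` by
the scalar of a highest weight vector of degree `p`. -/
theorem eq_zero_of_casimir_eigenvector (hE : ∀ j, ∀ m ∈ W j, E m ∈ W (j + 1))
    (hEF : ∀ j, ∀ m ∈ W j, E (F m) - F (E m) = (φ j - φ (j - 1)) • m)
    (hN : ∀ j, N ≤ j → W j = ⊥) {p j : ℤ} (hφ : ∀ l, j ≤ l → φ p ≠ φ l) {m : M} (hm : m ∈ W j)
    (h : F (E m) = (φ p - φ j) • m) : m = 0 := by
  obtain ⟨d, hd⟩ : ∃ d : ℕ, N ≤ j + d := ⟨(N - j).toNat, by omega⟩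
  induction d generalizing j m with
  | zero => simpa [hN j (by simpa using hd)] using hm
  | succ d ih =>
    have hEm : E m = 0 := by
      refine ih (fun l hl => hφ l (by omega)) (hE j m hm) ?_ (by push_cast at hd; omega)
      have h1 := hEF (j + 1) (E m) (hE j m hm)
      rw [h, map_smul, add_sub_cancel_right, sub_eq_iff_eq_add] at h1
      rw [← sub_eq_iff_eq_add'.2 h1, ← sub_smul]
      congr 1; ring
    rw [hEm, map_zero, eq_comm, smul_eq_zero] at h
    exact h.resolve_left (sub_ne_zero.2 (hφ j le_rfl))

theorem pow_lower_mem (hF : ∀ j, ∀ m ∈ W j, F m ∈ W (j - 1)) (r : ℕ) {j : ℤ} {m : M}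
    (hm : m ∈ W j) : (F ^ r) m ∈ W (j - r) := by
  induction r with
  | zero => simpa using hm
  | succ r ih =>
    rw [pow_succ', Module.End.mul_apply, Nat.cast_succ, ← sub_sub]
    exact hF _ _ ih

theorem pow_lower_casimir (hF : ∀ j, ∀ m ∈ W j, F m ∈ W (j - 1))
    (hEF : ∀ j, ∀ m ∈ W j, E (F m) - F (E m) = (φ j - φ (j - 1)) • m) (r : ℕ) {j : ℤ} {m : M}
    (hm : m ∈ W j) :
    (F ^ r) (F (E m)) = E ((F ^ (r + 1)) m) - (φ j - φ (j - r - 1)) • (F ^ r) m := by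
  induction r with
  | zero => simp [← hEF j m hm]
  | succ r ih =>
    have hr := hEF _ _ (pow_lower_mem hF (r + 1) hm)
    have hpow (n : ℕ) (x : M) : F ((F ^ n) x) = (F ^ (n + 1)) x := by
      rw [pow_succ', Module.End.mul_apply]
    rw [hpow (r + 1), Nat.cast_succ, ← sub_sub] at hr
    rw [← hpow, ih, map_sub, map_smul, hpow, eq_add_of_sub_eq' hr, Nat.cast_succ, ← sub_sub,
      ← sub_add_sub_cancel (φ j) (φ (j - r - 1)) (φ (j - r - 1 - 1)), add_smul]
    abel

theorem eq_zero_of_pow_lower_eq_zero (hE : ∀ j, ∀ m ∈ W j, E m ∈ W (j + 1))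
    (hF : ∀ j, ∀ m ∈ W j, F m ∈ W (j - 1))
    (hEF : ∀ j, ∀ m ∈ W j, E (F m) - F (E m) = (φ j - φ (j - 1)) • m)
    (hN : ∀ j, N ≤ j → W j = ⊥) (hφ : ∀ p l, |a + 2 * p + 1| < a + 2 * l + 1 → φ p ≠ φ l)
    {r : ℕ} {j : ℤ} (hr : r ≤ a + 2 * j) {m : M} (hm : m ∈ W j) (h : (F ^ r) m = 0) : m = 0 := by
  induction r generalizing j m with
  | zero => simpa using h
  | succ r ih =>
    push_cast at hr
    have hcas : F (E m) + (φ j - φ (j - r - 1)) • m = 0 := by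
      refine ih (by omega) (Submodule.add_mem _ ?_ (Submodule.smul_mem _ _ hm)) ?_
      · simpa using hF _ _ (hE j m hm)
      · rw [map_add, map_smul, pow_lower_casimir hF hEF r hm, h]
        simp
    refine eq_zero_of_casimir_eigenvector hE hEF hN (p := j - r - 1)
      (fun l hl => hφ _ _ (abs_lt.2 (by omega))) hm ?_
    rw [eq_neg_of_add_eq_zero_left hcas, ← neg_smul, neg_sub]

end Strings

theorem zpow_add_zpow_neg_ne {k : Type*} [Field k] {q : k} (hq0 : q ≠ 0)
    (hq : ∀ n : ℤ, n ≠ 0 → q ^ n ≠ 1) {A B : ℤ} (h : |A| < B) :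
    q ^ A + q ^ (-A) ≠ q ^ B + q ^ (-B) := by
  intro hAB
  have hA : q ^ A ≠ 0 := zpow_ne_zero A hq0
  have hB : q ^ B ≠ 0 := zpow_ne_zero B hq0
  have hfactor : (q ^ (A - B) - 1) * (1 - q ^ (-A - B)) =
      q ^ (-B) * (q ^ A + q ^ (-A) - (q ^ B + q ^ (-B))) := by
    rw [zpow_sub₀ hq0, zpow_sub₀ hq0, zpow_neg, zpow_neg]
    field_simp
    ring
  rw [hAB, sub_self, mul_zero] at hfactor
  rw [abs_lt] at h
  rcases mul_eq_zero.1 hfactor with h' | h'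
  · exact hq (A - B) (by omega) (sub_eq_zero.1 h')
  · exact hq (-A - B) (by omega) (sub_eq_zero.1 h').symm

/-! ### Coroots -/

/-- The integrality conditions under which the coroots `lam ↦ 2 (i · lam) / (i · i)` are defined on
`ℤ[I]`. -/
structure HasCoroots {I : Type*} (Ω : I → I → ℤ) : Prop where
  diag_ne_zero : ∀ i, Ω i i ≠ 0
  dvd : ∀ i j, Ω i i ∣ Ω i j + Ω j i

section Coroot

variable {I : Type u} {Ω : I → I → ℤ}

theorem IsCartan.hasCoroots [Fintype I] (hΩ : IsCartan Ω) : HasCoroots Ω where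
  diag_ne_zero i := (hΩ.diag_pos i).ne'
  dvd i j := by
    by_cases h : i = j
    · subst h; exact dvd_add_self_left.2 dvd_rfl
    · exact hΩ.dvd i j h

theorem HasCoroots.transp (hΩ : HasCoroots Ω) : HasCoroots (transp Ω) where
  diag_ne_zero := hΩ.diag_ne_zero
  dvd i j := by rw [TwoParam.transp, TwoParam.transp, add_comm]; exact hΩ.dvd i j

variable [Fintype I]

variable (Ω) in
/-- The coroot of `i`, with value `2 (i · j) / (i · i)` at `j`; the division is exact when
`HasCoroots Ω`. -/
def coroot (i : I) : (I → ℤ) →+ ℤ where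
  toFun lam := ∑ j, (Ω i j + Ω j i) / Ω i i * lam j
  map_zero' := by simp
  map_add' lam mu := by simp [mul_add, Finset.sum_add_distrib]

theorem coroot_apply (i : I) (lam : I → ℤ) :
    coroot Ω i lam = ∑ j, (Ω i j + Ω j i) / Ω i i * lam j := rfl

theorem coroot_transp (i : I) : coroot (transp Ω) i = coroot Ω i := by
  ext lam
  simp [coroot_apply, transp, add_comm]

variable [DecidableEq I] (hΩ : HasCoroots Ω)
include hΩ

theorem HasCoroots.coroot_e (i : I) : coroot Ω i (e i) = 2 := by
  simp [coroot_apply, e, Pi.single_apply, ← two_mul,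
    Int.mul_ediv_cancel _ (hΩ.diag_ne_zero i)]

theorem HasCoroots.diag_mul_coroot (i : I) (lam : I → ℤ) :
    Ω i i * coroot Ω i lam = dot Ω (e i) lam := by
  simp only [coroot_apply, dot, ang, e, Finset.mul_sum, ← mul_assoc,
    Int.mul_ediv_cancel' (hΩ.dvd i _)]
  simp [Pi.single_apply, mul_add, Finset.sum_add_distrib, mul_comm]

theorem HasCoroots.vi_zpow_coroot (i : I) (lam : I → ℤ) :
    vi Ω i ^ coroot Ω i lam = v ^ dot Ω (e i) lam := by
  rw [vi, ← zpow_mul, hΩ.diag_mul_coroot]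

end Coroot

/-! ### Weight representations -/

/-- A space graded by `ℤ[I]` with operators `E_i`, `F_i`, `K_i`, `K'_i` that satisfy the relations
of `U_{v,t}` other than the Serre relations. -/
structure WeightRep {I : Type u} [Fintype I] [DecidableEq I] (Ω : I → I → ℤ) (M : Type*)
    [AddCommGroup M] [Module 𝕜 M] where
  E : I → Module.End 𝕜 M
  F : I → Module.End 𝕜 M
  K : I → Module.End 𝕜 M
  K' : I → Module.End 𝕜 M
  V : (I → ℤ) → Submodule 𝕜 M
  iSupIndep_V : iSupIndep V
  iSup_V : ⨆ lam, V lam = ⊤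
  E_mem : ∀ i lam, ∀ m ∈ V lam, E i m ∈ V (lam + e i)
  F_mem : ∀ i lam, ∀ m ∈ V lam, F i m ∈ V (lam - e i)
  K_apply : ∀ i lam, ∀ m ∈ V lam, K i m = brace Ω (e i) lam • m
  K'_apply : ∀ i lam, ∀ m ∈ V lam, K' i m = (brace Ω lam (e i))⁻¹ • m
  E_F_same : ∀ i, E i * F i - F i * E i = (vi Ω i - (vi Ω i)⁻¹)⁻¹ • (K i - K' i)
  E_F_ne : ∀ i j, i ≠ j → E i * F j - F j * E i = 0

namespace WeightRep

variable {I : Type u} [Fintype I] [DecidableEq I] {Ω : I → I → ℤ} {M : Type*} [AddCommGroup M]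
  [Module 𝕜 M] (R : WeightRep Ω M)

/-- The representation of the transposed datum obtained by exchanging `E` with `F` and `K` with
`K'` and negating the weights. -/
def swap : WeightRep (transp Ω) M where
  E := R.F
  F := R.E
  K := R.K'
  K' := R.K
  V lam := R.V (-lam)
  iSupIndep_V := R.iSupIndep_V.comp neg_injective
  iSup_V := (Equiv.neg (I → ℤ)).iSup_comp.trans R.iSup_V
  E_mem i lam m hm := by
    rw [neg_add']
    exact R.F_mem i _ m hm
  F_mem i lam m hm := by
    rw [neg_sub', sub_neg_eq_add]
    exact R.E_mem i _ m hm
  K_apply i lam m hm := by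
    rw [R.K'_apply i _ m hm, brace_transp, brace_neg_left, inv_inv]
  K'_apply i lam m hm := by
    rw [R.K_apply i _ m hm, brace_transp, brace_neg_right]
  E_F_same i := by
    rw [show vi (transp Ω) i = vi Ω i from rfl, ← neg_sub (R.K i), smul_neg, ← R.E_F_same,
      neg_sub]
  E_F_ne i j h := by
    rw [← neg_sub, R.E_F_ne j i h.symm, neg_zero]

theorem swap_V (lam : I → ℤ) : R.swap.V lam = R.V (-lam) := rfl

/-- The action of `'f` through the `E_i`. -/
def plus : FF I →ₐ[𝕜] Module.End 𝕜 M := FreeAlgebra.lift 𝕜 R.E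

/-- The action of `'f` through the `F_i`. -/
def minus : FF I →ₐ[𝕜] Module.End 𝕜 M := FreeAlgebra.lift 𝕜 R.F

@[simp] theorem plus_ι (i : I) : R.plus (FreeAlgebra.ι 𝕜 i) = R.E i := by simp [plus]

@[simp] theorem minus_ι (i : I) : R.minus (FreeAlgebra.ι 𝕜 i) = R.F i := by simp [minus]

theorem swap_plus : R.swap.plus = R.minus := rfl

theorem linearMap_ext {N : Type*} [AddCommMonoid N] [Module 𝕜 N] {f g : M →ₗ[𝕜] N}
    (h : ∀ lam, ∀ m ∈ R.V lam, f m = g m) : f = g := by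
  have : (⊤ : Submodule 𝕜 M) ≤ LinearMap.eqLocus f g := by
    rw [← R.iSup_V]
    exact iSup_le fun lam m hm => h lam m hm
  ext m
  exact this trivial

theorem finite_weights [FiniteDimensional 𝕜 M] : {lam | R.V lam ≠ ⊥}.Finite :=
  WellFoundedGT.finite_ne_bot_of_iSupIndep R.iSupIndep_V

theorem plus_mem {mu : I → ℕ} {x : FF I} (hx : x ∈ homog mu) {lam : I → ℤ} {m : M}
    (hm : m ∈ R.V lam) : R.plus x m ∈ R.V (lam + toInt mu) := by
  suffices h : homog mu ≤ (R.V (lam + toInt mu)).comap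
      (LinearMap.applyₗ m ∘ₗ R.plus.toLinearMap) from h hx
  refine homog_le_of_word_mem fun w hw => ?_
  subst hw
  simp only [Submodule.mem_comap, LinearMap.comp_apply, AlgHom.toLinearMap_apply,
    LinearMap.applyₗ_apply_apply]
  clear hx
  induction w with
  | nil => simpa [show (fun _ : I => 0) = (0 : I → ℕ) from rfl] using hm
  | cons i w ih =>
    rw [word_cons, map_mul, plus_ι, count_cons_eq, toInt_add, toInt_single, ← add_assoc]
    exact R.E_mem i _ _ ih

theorem minus_mem {mu : I → ℕ} {x : FF I} (hx : x ∈ homog mu) {lam : I → ℤ} {m : M}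
    (hm : m ∈ R.V lam) : R.minus x m ∈ R.V (lam - toInt mu) := by
  have := R.swap.plus_mem hx (lam := -lam) (m := m) (by rwa [swap_V, neg_neg])
  rwa [swap_V, neg_add', neg_neg, swap_plus] at this

theorem K_mul_E (i j : I) : R.K i * R.E j = brace Ω (e i) (e j) • (R.E j * R.K i) := by
  refine R.linearMap_ext fun lam m hm => ?_
  simp only [Module.End.mul_apply, LinearMap.smul_apply, R.K_apply i _ _ hm, map_smul,
    R.K_apply i _ _ (R.E_mem j _ _ hm), brace_add_right, smul_smul, mul_comm]

theorem E_mul_K' (i j : I) : R.E j * R.K' i = brace Ω (e j) (e i) • (R.K' i * R.E j) := by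
  refine R.linearMap_ext fun lam m hm => ?_
  simp only [Module.End.mul_apply, LinearMap.smul_apply, R.K'_apply i _ _ hm, map_smul,
    R.K'_apply i _ _ (R.E_mem j _ _ hm), brace_add_left, smul_smul, mul_inv_rev]
  rw [mul_inv_cancel_left₀ (brace_ne_zero Ω _ _)]

theorem K_mul_plus (i : I) (x : FF I) :
    R.K i * R.plus x = R.plus (twist (braceRight Ω (e i)) x) * R.K i := by
  induction x using FreeAlgebra.induction with
  | grade0 r => simp [Algebra.commutes]
  | grade1 j => simp [K_mul_E]
  | add x y hx hy => simp only [map_add, mul_add, add_mul, hx, hy]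
  | mul x y hx hy => rw [map_mul, map_mul, map_mul, ← mul_assoc, hx, mul_assoc, hy, mul_assoc]

theorem K'_mul_minus (i : I) (x : FF I) :
    R.K' i * R.minus x = R.minus (twist (braceLeft Ω (e i)) x) * R.K' i := by
  have h : braceRight (transp Ω) (e i) = braceLeft Ω (e i) :=
    DFunLike.ext _ _ fun lam => brace_transp Ω _ lam
  exact h ▸ R.swap.K_mul_plus i x

theorem plus_mul_F_sub (i : I) (x : FF I) : R.plus x * R.F i - R.F i * R.plus x =
    (vi Ω i - (vi Ω i)⁻¹)⁻¹ •
      (R.plus (derR Ω i x) * R.K i - R.K' i * R.plus (derL Ω i x)) := by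
  suffices h : LinearMap.mulRight 𝕜 (R.F i) ∘ₗ R.plus.toLinearMap -
      LinearMap.mulLeft 𝕜 (R.F i) ∘ₗ R.plus.toLinearMap =
      (vi Ω i - (vi Ω i)⁻¹)⁻¹ •
        (LinearMap.mulRight 𝕜 (R.K i) ∘ₗ R.plus.toLinearMap ∘ₗ derR Ω i -
          LinearMap.mulLeft 𝕜 (R.K' i) ∘ₗ R.plus.toLinearMap ∘ₗ derL Ω i) from
    LinearMap.congr_fun h x
  refine linearMap_ext_ι_mul (by simp [derL, derR]) fun j x ih => ?_
  simp only [LinearMap.sub_apply, LinearMap.comp_apply, LinearMap.smul_apply,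
    LinearMap.mulRight_apply, LinearMap.mulLeft_apply, AlgHom.toLinearMap_apply] at ih ⊢
  have hLeibniz : R.E j * R.plus x * R.F i - R.F i * (R.E j * R.plus x) =
      R.E j * (R.plus x * R.F i - R.F i * R.plus x) +
        (R.E j * R.F i - R.F i * R.E j) * R.plus x := by noncomm_ring
  rw [map_mul, plus_ι, hLeibniz, ih, derR_ι_mul, derL_ι_mul]
  by_cases hj : j = i
  · subst hj
    rw [R.E_F_same]
    simp only [if_true, map_add, map_mul, map_smul, plus_ι, mul_add, add_mul, mul_sub, sub_mul,
      smul_sub, smul_add, mul_smul_comm, smul_mul_assoc, ← mul_assoc, E_mul_K', K_mul_plus]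
    abel
  · rw [R.E_F_ne j i hj]
    simp only [if_neg hj, map_mul, map_smul, plus_ι, mul_sub, smul_sub, mul_smul_comm,
      smul_mul_assoc, ← mul_assoc, E_mul_K', zero_mul, add_zero]

end WeightRep

/-! ### Weight representations as representations of `sl₂` -/

section Cc

variable {I : Type u} [Fintype I] [DecidableEq I] {Ω : I → I → ℤ}

theorem cc_add_zsmul_e (i : I) (lam : I → ℤ) (j : ℤ) : cc Ω i (lam + j • e i) = cc Ω i lam := by
  have hleft : ang Ω (j • e i) (e i) = j * ang Ω (e i) (e i) := by
    simp [ang, Finset.mul_sum, mul_assoc]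
  have hright : ang Ω (e i) (j • e i) = j * ang Ω (e i) (e i) := by
    simp [ang, Finset.mul_sum, mul_left_comm]
  rw [cc, cc, ang_add_left, ang_add_right, hleft, hright, add_sub_add_right_eq_sub]

variable (hΩ : HasCoroots Ω)
include hΩ

theorem HasCoroots.brace_e_left (i : I) (lam : I → ℤ) :
    brace Ω (e i) lam = cc Ω i lam * vi Ω i ^ coroot Ω i lam := by
  rw [brace, cc, hΩ.vi_zpow_coroot, mul_comm]

theorem HasCoroots.brace_e_right_inv (i : I) (lam : I → ℤ) :
    (brace Ω lam (e i))⁻¹ = cc Ω i lam * vi Ω i ^ (-coroot Ω i lam) := by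
  rw [brace, cc, zpow_neg, hΩ.vi_zpow_coroot, mul_inv_rev, ← zpow_neg t, neg_sub, dot, dot,
    add_comm (ang Ω lam (e i))]

end Cc

theorem zpow_string_sub {k : Type*} [Field k] {q : k} (hq0 : q ≠ 0) (A : ℤ) :
    q ^ (A + 1) + q ^ (-(A + 1)) - (q ^ (A - 1) + q ^ (-(A - 1))) =
      (q - q⁻¹) * (q ^ A - q ^ (-A)) := by
  rw [neg_add', neg_sub, sub_eq_neg_add 1, zpow_add_one₀ hq0, zpow_sub_one₀ hq0,
    zpow_sub_one₀ hq0, zpow_add_one₀ hq0]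
  ring

namespace WeightRep

variable {I : Type u} [Fintype I] [DecidableEq I] {Ω : I → I → ℤ} {M : Type*} [AddCommGroup M]
  [Module 𝕜 M] (R : WeightRep Ω M)

theorem pow_F_mem (i : I) (r : ℕ) {lam : I → ℤ} {m : M} (hm : m ∈ R.V lam) :
    (R.F i ^ r) m ∈ R.V (lam - (r : ℤ) • e i) := by
  induction r with
  | zero => simpa using hm
  | succ r ih =>
    rw [pow_succ', Module.End.mul_apply, Nat.cast_succ, add_one_zsmul, ← sub_sub]
    exact R.F_mem i _ _ ih

theorem pow_E_mem (i : I) (r : ℕ) {lam : I → ℤ} {m : M} (hm : m ∈ R.V lam) :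
    (R.E i ^ r) m ∈ R.V (lam + (r : ℤ) • e i) := by
  have := R.swap.pow_F_mem i r (lam := -lam) (m := m) (by rwa [swap_V, neg_neg])
  rwa [swap_V, neg_sub', neg_neg, sub_neg_eq_add] at this

theorem exists_string_bound [FiniteDimensional 𝕜 M] (i : I) (lam : I → ℤ) :
    ∃ N : ℕ, ∀ j : ℤ, N ≤ j → R.V (lam + j • e i) = ⊥ := by
  have hinj : Function.Injective fun j : ℤ => lam + j • e i := fun a b h => by
    simpa [e] using congrFun h i
  obtain ⟨N, hN⟩ := (R.finite_weights.preimage hinj.injOn).bddAbove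
  refine ⟨(N + 1).toNat, fun j hj => ?_⟩
  by_contra h
  have : j ≤ N := hN h
  omega

variable (hΩ : HasCoroots Ω)
include hΩ

theorem E_F_sub_F_E_apply (i : I) {lam : I → ℤ} {m : M} (hm : m ∈ R.V lam) :
    R.E i (R.F i m) - R.F i (R.E i m) = ((vi Ω i - (vi Ω i)⁻¹)⁻¹ *
      (cc Ω i lam * (vi Ω i ^ coroot Ω i lam - vi Ω i ^ (-coroot Ω i lam)))) • m := by
  have h := LinearMap.congr_fun (R.E_F_same i) m
  simp only [LinearMap.sub_apply, Module.End.mul_apply, LinearMap.smul_apply,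
    R.K_apply i _ m hm, R.K'_apply i _ m hm] at h
  rw [h, hΩ.brace_e_left, hΩ.brace_e_right_inv, ← sub_smul, smul_smul, ← mul_sub]

variable [FiniteDimensional 𝕜 M]

theorem eq_zero_of_pow_F_eq_zero (i : I) {lam : I → ℤ} {r : ℕ} (hr : r ≤ coroot Ω i lam) {m : M}
    (hm : m ∈ R.V lam) (h : (R.F i ^ r) m = 0) : m = 0 := by
  obtain ⟨N, hN⟩ := R.exists_string_bound i lam
  set q := vi Ω i
  set a := coroot Ω i lam
  have hq0 : q ≠ 0 := vi_ne_zero Ω i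
  have hq : q - q⁻¹ ≠ 0 := vi_sub_inv_ne_zero (hΩ.diag_ne_zero i)
  have hcc : cc Ω i lam ≠ 0 := zpow_ne_zero _ t_ne_zero
  let κ : 𝕜 := (q - q⁻¹)⁻¹ * ((q - q⁻¹)⁻¹ * cc Ω i lam)
  have hκ : κ ≠ 0 := mul_ne_zero (inv_ne_zero hq) (mul_ne_zero (inv_ne_zero hq) hcc)
  refine eq_zero_of_pow_lower_eq_zero (E := R.E i) (F := R.F i) (a := a) (j := 0) (N := N)
    (W := fun j => R.V (lam + j • e i))
    (φ := fun j => κ * (q ^ (a + 2 * j + 1) + q ^ (-(a + 2 * j + 1))))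
    (fun j m hm => ?_) (fun j m hm => ?_) (fun j m hm => ?_) hN (fun p l hpl hφ => ?_)
    (by simpa using hr) (by simpa using hm) h
  · have := R.E_mem i _ m hm
    rwa [add_assoc, ← add_one_zsmul] at this
  · have := R.F_mem i _ m hm
    rwa [add_sub_assoc, sub_eq_add_neg, ← sub_one_zsmul] at this
  · have hcoroot : coroot Ω i (lam + j • e i) = a + 2 * j := by
      rw [map_add, map_zsmul, hΩ.coroot_e, smul_eq_mul, mul_comm]
    rw [R.E_F_sub_F_E_apply hΩ i hm, cc_add_zsmul_e, hcoroot, ← mul_sub,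
      show a + 2 * (j - 1) + 1 = a + 2 * j - 1 by ring, zpow_string_sub hq0]
    congr 1
    linear_combination -(q - q⁻¹)⁻¹ * cc Ω i lam * (q ^ (a + 2 * j) - q ^ (-(a + 2 * j))) *
      inv_mul_cancel₀ hq
  · exact zpow_add_zpow_neg_ne hq0 (fun n hn => vi_zpow_ne_one (hΩ.diag_ne_zero i) hn) hpl
      (mul_left_cancel₀ hκ hφ)

theorem eq_zero_of_pow_E_eq_zero (i : I) {lam : I → ℤ} {r : ℕ} (hr : r ≤ -coroot Ω i lam) {m : M}
    (hm : m ∈ R.V lam) (h : (R.E i ^ r) m = 0) : m = 0 :=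
  R.swap.eq_zero_of_pow_F_eq_zero hΩ.transp i (lam := -lam) (by rwa [coroot_transp, map_neg])
    (by rwa [swap_V, neg_neg]) h

theorem exists_pow_F_eq (i : I) {lam : I → ℤ} {n : ℕ} (hn : coroot Ω i lam = n) {m : M}
    (hm : m ∈ R.V (lam - (n : ℤ) • e i)) : ∃ m' ∈ R.V lam, (R.F i ^ n) m' = m := by
  let A : R.V lam →ₗ[𝕜] R.V (lam - (n : ℤ) • e i) :=
    (R.F i ^ n).restrict fun m hm => R.pow_F_mem i n hm
  let B : R.V (lam - (n : ℤ) • e i) →ₗ[𝕜] R.V lam :=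
    (R.E i ^ n).restrict fun m hm => by simpa using R.pow_E_mem i n hm
  have hA : Function.Injective A := (injective_iff_map_eq_zero A).2 fun x hx =>
    Subtype.ext (R.eq_zero_of_pow_F_eq_zero hΩ i hn.ge x.2 (congrArg Subtype.val hx))
  have hcoroot : (n : ℤ) ≤ -coroot Ω i (lam - (n : ℤ) • e i) := by
    rw [map_sub, map_zsmul, hΩ.coroot_e, hn, smul_eq_mul]
    omega
  have hB : Function.Injective B := (injective_iff_map_eq_zero B).2 fun x hx =>
    Subtype.ext (R.eq_zero_of_pow_E_eq_zero hΩ i hcoroot x.2 (congrArg Subtype.val hx))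
  have hAB : Function.Surjective (A ∘ₗ B) := LinearMap.injective_iff_surjective.1 (hA.comp hB)
  obtain ⟨x, hx⟩ := hAB ⟨m, hm⟩
  exact ⟨B x, (B x).2, congrArg Subtype.val hx⟩

theorem reflection_ne_bot (i : I) {lam : I → ℤ} (h : R.V lam ≠ ⊥) :
    R.V (lam - coroot Ω i lam • e i) ≠ ⊥ := by
  obtain ⟨m, hm, hm0⟩ := Submodule.exists_mem_ne_zero_of_ne_bot h
  rcases le_total 0 (coroot Ω i lam) with hsign | hsign
  · obtain ⟨n, hn⟩ := Int.eq_ofNat_of_zero_le hsign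
    rw [hn]
    exact (Submodule.ne_bot_iff _).2 ⟨_, R.pow_F_mem i n hm,
      fun h => hm0 (R.eq_zero_of_pow_F_eq_zero hΩ i hn.ge hm h)⟩
  · obtain ⟨n, hn⟩ := Int.exists_eq_neg_ofNat hsign
    rw [hn, neg_smul, sub_neg_eq_add]
    exact (Submodule.ne_bot_iff _).2 ⟨_, R.pow_E_mem i n hm,
      fun h => hm0 (R.eq_zero_of_pow_E_eq_zero hΩ i (by rw [hn, neg_neg]) hm h)⟩

omit [FiniteDimensional 𝕜 M] in
theorem exists_coroot_ne_zero {i : I} (hi : R.E i ≠ 0) :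
    ∃ lam, R.V lam ≠ ⊥ ∧ coroot Ω i lam ≠ 0 := by
  contrapose! hi
  refine R.linearMap_ext fun lam m hm => ?_
  by_contra hne
  rw [LinearMap.zero_apply] at hne
  have hsource : R.V lam ≠ ⊥ :=
    (Submodule.ne_bot_iff _).2 ⟨m, hm, fun h => hne (by rw [h, map_zero])⟩
  have htarget : R.V (lam + e i) ≠ ⊥ := (Submodule.ne_bot_iff _).2 ⟨_, R.E_mem i lam m hm, hne⟩
  have := hi _ htarget
  rw [map_add, hi _ hsource, hΩ.coroot_e] at this
  omega

theorem exists_coroot_pos {mu : I → ℕ} (hmu : mu ≠ 0) (hE : ∀ i, mu i ≠ 0 → R.E i ≠ 0) :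
    ∃ i, mu i ≠ 0 ∧ 0 < coroot Ω i (toInt mu) := by
  have : Finite {lam // R.V lam ≠ ⊥} := R.finite_weights.to_subtype
  let J : Finset I := {i | mu i ≠ 0}
  have hJ : ∑ i ∈ J, mu i • e i = toInt mu := by
    rw [Finset.sum_filter_of_ne (p := fun i => mu i ≠ 0) fun i _ h hi => h (by rw [hi, zero_smul])]
    ext k
    simp [e, toInt, Pi.single_apply]
  let s (i : I) : Equiv.Perm {lam // R.V lam ≠ ⊥} := Function.Involutive.toPerm
    (fun ρ => ⟨_, R.reflection_ne_bot hΩ i ρ.2⟩) fun ρ => Subtype.ext <| by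
      simp only [map_sub, map_zsmul, hΩ.coroot_e, smul_eq_mul]
      module
  have hwt (i : I) (hi : i ∈ J) : ∃ ρ : {lam // R.V lam ≠ ⊥}, coroot Ω i ρ.1 ≠ 0 := by
    obtain ⟨lam, hlam, h⟩ := R.exists_coroot_ne_zero hΩ (hE i (Finset.mem_filter.1 hi).2)
    exact ⟨⟨lam, hlam⟩, h⟩
  obtain ⟨k, hk⟩ := Function.ne_iff.1 hmu
  obtain ⟨i, hi, hpos⟩ := exists_coroot_pos_of_finite_reflections (s := s) hΩ.coroot_e
    (fun _ _ => rfl) hwt (c := mu) (η := (Int.castAddHom ℚ).comp (Pi.evalAddMonoidHom _ k))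
    (by rw [hJ]; simpa [toInt] using hk)
  exact ⟨i, (Finset.mem_filter.1 hi).2, hJ ▸ hpos⟩

end WeightRep

/-! ### The radicals of the pairing act by zero -/

section Radical

variable {I : Type u} [DecidableEq I]

theorem eq_algebraMap_aug_of_mem_homog_zero {x : FF I} (hx : x ∈ homog 0) :
    x = algebraMap 𝕜 (FF I) (aug x) := by
  suffices h : homog 0 ≤ LinearMap.eqLocus LinearMap.id
      (Algebra.linearMap 𝕜 (FF I) ∘ₗ aug.toLinearMap) from h hx
  refine homog_le_of_word_mem fun w hw => ?_
  have : w = [] := List.eq_nil_iff_forall_not_mem.2 fun i => List.count_eq_zero.1 (congrFun hw i)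
  simp [this]

end Radical

namespace WeightRep

variable {I : Type u} [Fintype I] [DecidableEq I] {Ω : I → I → ℤ} {M : Type*} [AddCommGroup M]
  [Module 𝕜 M] (R : WeightRep Ω M)

theorem plus_eq_zero_of_E_eq_zero {i : I} (hi : R.E i = 0) {mu : I → ℕ} (hmu : mu i ≠ 0)
    {x : FF I} (hx : x ∈ homog mu) : R.plus x = 0 := by
  suffices h : homog mu ≤ LinearMap.ker R.plus.toLinearMap from h hx
  refine homog_le_of_word_mem fun w hw => ?_
  obtain ⟨a, b, rfl⟩ := List.append_of_mem
    (List.count_pos_iff.1 (Nat.pos_of_ne_zero ((congrFun hw i).trans_ne hmu)))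
  simp [word_append, word_cons, hi]

variable (hΩ : HasCoroots Ω) [FiniteDimensional 𝕜 M]
include hΩ

section CommuteF

variable {i : I} {nu : I → ℤ} (hnu : 0 < coroot Ω i nu) {f : Module.End 𝕜 M}
  (hf : ∀ lam, ∀ m ∈ R.V lam, f m ∈ R.V (lam + nu)) (hcomm : Commute f (R.F i))
include hnu hf hcomm

/-- Descending induction along the `i`-string: on `M_{lam + i}` the operator `f` vanishes, and
`F_i^{n+1} m` lies in `F_i^{n+2} M_{lam + i}` for `n = coroot i lam`. -/
theorem apply_eq_zero_of_commute_F_of_nonneg {lam : I → ℤ} (hlam : 0 ≤ coroot Ω i lam) {m : M}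
    (hm : m ∈ R.V lam) : f m = 0 := by
  have hpow (n : ℕ) (m : M) : f ((R.F i ^ n) m) = (R.F i ^ n) (f m) :=
    LinearMap.congr_fun (hcomm.pow_right n).eq m
  obtain ⟨N, hN⟩ := R.exists_string_bound i lam
  induction N generalizing lam m with
  | zero =>
    have hbot : R.V lam = ⊥ := by simpa using hN 0 le_rfl
    rw [hbot, Submodule.mem_bot] at hm
    rw [hm, map_zero]
  | succ N ih =>
    obtain ⟨n, hn⟩ := Int.eq_ofNat_of_zero_le hlam
    have hsucc : coroot Ω i (lam + e i) = (n + 2 : ℕ) := by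
      rw [map_add, hΩ.coroot_e, hn]; rfl
    have hmem : (R.F i ^ (n + 1)) m ∈ R.V (lam + e i - ((n + 2 : ℕ) : ℤ) • e i) := by
      convert R.pow_F_mem i (n + 1) hm using 2
      push_cast
      module
    obtain ⟨m', hm', h⟩ := R.exists_pow_F_eq hΩ i hsucc hmem
    have hfm' : f m' = 0 := ih (by omega) hm' fun j hj => by
      have := hN (j + 1) (by push_cast; omega)
      rwa [add_one_zsmul, add_comm _ (e i), ← add_assoc] at this
    refine R.eq_zero_of_pow_F_eq_zero hΩ i (r := n + 1) ?_ (hf lam m hm) ?_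
    · rw [map_add, hn]; push_cast; omega
    · rw [← hpow, ← h, hpow, hfm', map_zero]

theorem eq_zero_of_commute_F : f = 0 := by
  refine R.linearMap_ext fun lam m hm => ?_
  rw [LinearMap.zero_apply]
  rcases le_total 0 (coroot Ω i lam) with h | h
  · exact R.apply_eq_zero_of_commute_F_of_nonneg hΩ hnu hf hcomm h hm
  · obtain ⟨n, hn⟩ := Int.exists_eq_neg_ofNat h
    have hrefl : coroot Ω i (lam + (n : ℤ) • e i) = n := by
      rw [map_add, map_zsmul, hΩ.coroot_e, hn, smul_eq_mul]; ring
    obtain ⟨m', hm', rfl⟩ := R.exists_pow_F_eq hΩ i hrefl (m := m) (by simpa using hm)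
    rw [show f ((R.F i ^ n) m') = (R.F i ^ n) (f m') from
        LinearMap.congr_fun (hcomm.pow_right n).eq m',
      R.apply_eq_zero_of_commute_F_of_nonneg hΩ hnu hf hcomm (by omega) hm', map_zero]

end CommuteF

theorem plus_eq_zero_of_pair_eq_zero {mu : I → ℕ} {x : FF I} (hx : x ∈ homog mu)
    (h : ∀ y, pair Ω x y = 0) : R.plus x = 0 := by
  induction mu using WellFoundedLT.induction generalizing x with
  | ind mu ih =>
  rcases eq_or_ne mu 0 with rfl | hmu
  · rw [eq_algebraMap_aug_of_mem_homog_zero hx, ← pair_one_right Ω, h, map_zero, map_zero]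
  by_cases hE : ∀ i, mu i ≠ 0 → R.E i ≠ 0
  · obtain ⟨i, hi, hpos⟩ := R.exists_coroot_pos hΩ hmu hE
    obtain ⟨nu, rfl⟩ : ∃ nu : I → ℕ, mu = nu + Pi.single i 1 :=
      ⟨_, (tsub_add_cancel_of_le (single_one_le (Nat.pos_of_ne_zero hi))).symm⟩
    have hlt : nu < nu + Pi.single i 1 := lt_add_of_pos_right nu (by simp [Pi.single_pos])
    have hC : pairC Ω i ≠ 0 :=
      inv_ne_zero (neg_sub (vi Ω i) _ ▸ neg_ne_zero.2 (vi_sub_inv_ne_zero (hΩ.diag_ne_zero i)))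
    have hL : R.plus (derL Ω i x) = 0 := ih nu hlt (skewDer_mem_homog _ _ i hx) fun y =>
      (mul_eq_zero.1 ((pair_ι_mul_right Ω i x y).symm.trans (h _))).resolve_left hC
    have hR : R.plus (derR Ω i x) = 0 := ih nu hlt (skewDer_mem_homog _ _ i hx) fun y =>
      (mul_eq_zero.1 ((pair_mul_ι_right Ω i x y).symm.trans (h _))).resolve_left hC
    refine R.eq_zero_of_commute_F hΩ hpos (fun lam m hm => R.plus_mem hx hm) ?_
    have hcomm := R.plus_mul_F_sub i x
    rw [hL, hR, zero_mul, mul_zero, sub_zero, smul_zero] at hcomm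
    exact sub_eq_zero.1 hcomm
  · push Not at hE
    obtain ⟨i, hi, hEi⟩ := hE
    exact R.plus_eq_zero_of_E_eq_zero hEi hi hx

end WeightRep

/-! ### The quasi-R-matrix -/

/-- A finite family of pairs of elements of `'f` of equal degree, such as a pair of dual bases in
finitely many degrees. It stands for the tensor `∑ b ⊗ bs`. -/
structure HomogFamily (I : Type*) [DecidableEq I] where
  index : Type*
  [fintype : Fintype index]
  deg : index → I → ℕ
  b : index → FF I
  bs : index → FF I
  b_mem : ∀ k, b k ∈ homog (deg k)
  bs_mem : ∀ k, bs k ∈ homog (deg k)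

attribute [instance] HomogFamily.fintype

theorem map_smulRight {k P Q M N : Type*} [CommRing k] [AddCommGroup P] [Module k P]
    [AddCommGroup Q] [Module k Q] [AddCommGroup M] [Module k M] [AddCommGroup N] [Module k N]
    (f : P →ₗ[k] k) (g : Q →ₗ[k] k) (m : M) (n : N) :
    TensorProduct.map (f.smulRight m) (g.smulRight n) =
      (LinearMap.mul' k k ∘ₗ TensorProduct.map f g).smulRight (m ⊗ₜ[k] n) :=
  TensorProduct.ext' fun x y => TensorProduct.smul_tmul_smul (f x) (g y) m n

namespace WeightRep

variable {I : Type u} [Fintype I] [DecidableEq I] {Ω : I → I → ℤ}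
  {M : Type*} [AddCommGroup M] [Module 𝕜 M] (R : WeightRep Ω M)
  {M' : Type*} [AddCommGroup M'] [Module 𝕜 M'] (R' : WeightRep Ω M')
  {M'' : Type*} [AddCommGroup M''] [Module 𝕜 M''] {R'' : WeightRep Ω M''}

/-- The family behaves on `M` like a pair of dual bases of `'f` for the pairing. -/
structure Reproduces (B : HomogFamily I) : Prop where
  plus : ∀ x, R.plus x = ∑ k, pair Ω x (B.b k) • R.plus (B.bs k)
  minus : ∀ y, R.minus y = ∑ k, pair Ω (B.bs k) y • R.minus (B.b k)

/-- The quasi-R-matrix `Θ = ∑ b ⊗ b*` on `M ⊗ M'`. -/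
def theta (B : HomogFamily I) : Module.End 𝕜 (M ⊗[𝕜] M') :=
  ∑ k, TensorProduct.map (R.minus (B.b k)) (R'.plus (B.bs k))

/-- The action of `'f` on `M ⊗ M'` through `Δ(F_i) = 1 ⊗ F_i + F_i ⊗ K'_i`. -/
def coprod : FF I →ₐ[𝕜] Module.End 𝕜 (M ⊗[𝕜] M') :=
  FreeAlgebra.lift 𝕜 fun i =>
    TensorProduct.map 1 (R'.F i) + TensorProduct.map (R.F i) (R'.K' i)

/-- `r` is the operator `Θ ∘ f̃ ∘ P`, where `P` is the flip. -/
def IsRMatrix (B : HomogFamily I) (r : M ⊗[𝕜] M' →ₗ[𝕜] M' ⊗[𝕜] M) : Prop :=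
  ∀ lam mu, ∀ m ∈ R.V lam, ∀ m' ∈ R'.V mu,
    r (m ⊗ₜ m') = (brace Ω mu lam)⁻¹ • R'.theta R B (m' ⊗ₜ m)

theorem theta_tmul (B : HomogFamily I) (m : M) (m' : M') :
    R.theta R' B (m ⊗ₜ m') = ∑ k, R.minus (B.b k) m ⊗ₜ R'.plus (B.bs k) m' := by
  simp only [theta, LinearMap.sum_apply, TensorProduct.map_tmul]

theorem tensor_ext {N : Type*} [AddCommMonoid N] [Module 𝕜 N] {f g : M ⊗[𝕜] M' →ₗ[𝕜] N}
    (h : ∀ lam mu, ∀ m ∈ R.V lam, ∀ m' ∈ R'.V mu, f (m ⊗ₜ m') = g (m ⊗ₜ m')) : f = g :=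
  TensorProduct.ext <| R.linearMap_ext fun lam m hm => R'.linearMap_ext fun mu m' hm' =>
    h lam mu m hm m' hm'

variable {R R'} {B : HomogFamily I}

section Intertwine

variable (hR : R.Reproduces B) (hR' : R'.Reproduces B)
include hR hR'

theorem sum_map_adjoint {φ ψ : FF I → FF I} (h : ∀ x y, pair Ω (φ x) y = pair Ω x (ψ y)) :
    ∑ k, TensorProduct.map (R.minus (ψ (B.b k))) (R'.plus (B.bs k)) =
      ∑ k, TensorProduct.map (R.minus (B.b k)) (R'.plus (φ (B.bs k))) := by
  simp only [hR.minus (ψ _), hR'.plus (φ _), ← h, ← TensorProduct.mapBilinear_apply, map_sum,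
    map_smul, LinearMap.sum_apply, LinearMap.smul_apply]
  exact Finset.sum_comm

theorem theta_mul_map_F (i : I) : R.theta R' B * TensorProduct.map (R.F i) 1 =
    pairC Ω i • ∑ k, TensorProduct.map (R.minus (B.b k)) (R'.plus (derR Ω i (B.bs k))) := by
  have h := sum_map_adjoint hR hR' (φ := pairC Ω i • derR Ω i)
    (ψ := fun y => y * FreeAlgebra.ι 𝕜 i) fun x y => by simp [pair_mul_ι_right]
  simpa [theta, Finset.sum_mul, Finset.smul_sum, ← TensorProduct.map_mul,
    TensorProduct.map_smul_right] using h

theorem map_F_mul_theta (i : I) : TensorProduct.map (R.F i) 1 * R.theta R' B =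
    pairC Ω i • ∑ k, TensorProduct.map (R.minus (B.b k)) (R'.plus (derL Ω i (B.bs k))) := by
  have h := sum_map_adjoint hR hR' (φ := pairC Ω i • derL Ω i)
    (ψ := fun y => FreeAlgebra.ι 𝕜 i * y) fun x y => by simp [pair_ι_mul_right]
  simpa [theta, Finset.mul_sum, Finset.smul_sum, ← TensorProduct.map_mul,
    TensorProduct.map_smul_right] using h

theorem theta_mul_F (i : I) :
    R.theta R' B * (TensorProduct.map 1 (R'.F i) + TensorProduct.map (R.F i) (R'.K i)) =
      (TensorProduct.map 1 (R'.F i) + TensorProduct.map (R.F i) (R'.K' i)) * R.theta R' B := by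
  have hK : TensorProduct.map (R.F i) (R'.K i) =
      TensorProduct.map (R.F i) 1 * TensorProduct.map 1 (R'.K i) := by
    rw [← TensorProduct.map_mul, mul_one, one_mul]
  have hK' : TensorProduct.map (R.F i) (R'.K' i) =
      TensorProduct.map 1 (R'.K' i) * TensorProduct.map (R.F i) 1 := by
    rw [← TensorProduct.map_mul, mul_one, one_mul]
  have hC : (vi Ω i - (vi Ω i)⁻¹)⁻¹ = -pairC Ω i := by rw [pairC, ← neg_sub, inv_neg]
  have hterm (x : FF I) : R'.plus x * R'.F i + pairC Ω i • (R'.plus (derR Ω i x) * R'.K i) =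
      R'.F i * R'.plus x + pairC Ω i • (R'.K' i * R'.plus (derL Ω i x)) := by
    have h := R'.plus_mul_F_sub i x
    rw [hC, neg_smul, smul_sub, neg_sub] at h
    rw [add_comm (R'.F i * _), ← sub_eq_sub_iff_add_eq_add, h]
  rw [mul_add, add_mul, hK, hK', ← mul_assoc, mul_assoc _ _ (R.theta R' B),
    theta_mul_map_F hR hR', map_F_mul_theta hR hR']
  simp only [theta, Finset.sum_mul, Finset.mul_sum, smul_mul_assoc, mul_smul_comm,
    ← TensorProduct.map_mul, mul_one, one_mul, Finset.smul_sum, ← Finset.sum_add_distrib,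
    ← TensorProduct.map_smul_right, ← TensorProduct.map_add_right, hterm]

theorem IsRMatrix.apply_coprod {r : M ⊗[𝕜] M' →ₗ[𝕜] M' ⊗[𝕜] M} (hr : IsRMatrix R R' B r)
    (y : FF I) (u : M ⊗[𝕜] M') : r (R.coprod R' y u) = R'.coprod R y (r u) := by
  induction y using FreeAlgebra.induction generalizing u with
  | grade0 c => simp [Module.algebraMap_end_apply]
  | grade1 i =>
    suffices h : r ∘ₗ R.coprod R' (FreeAlgebra.ι 𝕜 i) = R'.coprod R (FreeAlgebra.ι 𝕜 i) ∘ₗ r from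
      LinearMap.congr_fun h u
    refine R.tensor_ext R' fun lam mu m hm m' hm' => ?_
    have hF := LinearMap.congr_fun (theta_mul_F hR' hR i) (m' ⊗ₜ m)
    simp only [Module.End.mul_apply, LinearMap.add_apply, TensorProduct.map_tmul,
      Module.End.one_apply, map_add, R.K_apply i _ m hm, TensorProduct.tmul_smul,
      map_smul] at hF
    simp only [coprod, FreeAlgebra.lift_ι_apply, LinearMap.comp_apply,
      LinearMap.add_apply, TensorProduct.map_tmul, Module.End.one_apply, map_add,
      R'.K'_apply i _ m' hm', TensorProduct.tmul_smul, map_smul, hr _ _ m hm m' hm',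
      hr _ _ _ (R.F_mem i _ m hm) _ hm', hr _ _ _ hm _ (R'.F_mem i _ m' hm'), ← hF]
    have := brace_ne_zero Ω mu (e i)
    rw [smul_add, smul_smul, smul_smul, brace_sub_left, brace_sub_right, add_comm]
    congr 2 <;> field_simp
  | add x y hx hy => simp only [map_add, LinearMap.add_apply, hx, hy]
  | mul x y hx hy => simp only [map_mul, Module.End.mul_apply, hx, hy]

end Intertwine

theorem coprod_tmul {mu : I → ℤ} (m : M) {m' : M'} (hm' : m' ∈ R'.V mu) (y : FF I) :
    R.coprod R' y (m ⊗ₜ m') = TensorProduct.comm 𝕜 M' M (TensorProduct.map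
      (LinearMap.applyₗ m' ∘ₗ R'.minus.toLinearMap)
      (LinearMap.applyₗ m ∘ₗ (R.minus.comp (twist (braceRight Ω (-mu)))).toLinearMap)
      (twistedComul Ω y)) := by
  let A := LinearMap.applyₗ m' ∘ₗ R'.minus.toLinearMap
  let A' := LinearMap.applyₗ m ∘ₗ (R.minus.comp (twist (braceRight Ω (-mu)))).toLinearMap
  let φ := (TensorProduct.comm 𝕜 M' M).toLinearMap ∘ₗ TensorProduct.map A A'
  have hι (i : I) : R.coprod R' (FreeAlgebra.ι 𝕜 i) ∘ₗ φ =
      φ ∘ₗ ((LinearMap.mulLeft 𝕜 (FreeAlgebra.ι 𝕜 i)).rTensor (FF I) +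
        TensorProduct.map (twist (braceLeft Ω (e i))).toLinearMap
          (LinearMap.mulLeft 𝕜 (FreeAlgebra.ι 𝕜 i))) := by
    refine TensorProduct.ext' fun a b => ?_
    have hK : R'.minus (twist (braceLeft Ω (e i)) a) m' =
        brace Ω mu (e i) • R'.K' i (R'.minus a m') := by
      have h := LinearMap.congr_fun (R'.K'_mul_minus i a) m'
      rw [Module.End.mul_apply, Module.End.mul_apply, R'.K'_apply i _ m' hm', map_smul] at h
      rw [h, smul_inv_smul₀ (brace_ne_zero Ω _ _)]
    simp [φ, A, A', coprod, hK, brace_neg_left, TensorProduct.smul_tmul, smul_smul, brace_ne_zero]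
  refine LinearMap.congr_fun (f := LinearMap.applyₗ (m ⊗ₜ m') ∘ₗ (R.coprod R').toLinearMap)
    (g := φ ∘ₗ twistedComul Ω) (linearMap_ext_ι_mul ?_ fun i y hy => ?_) y
  · simp [φ, A, A']
  · have h := LinearMap.congr_fun (hι i) (twistedComul Ω y)
    simp only [LinearMap.comp_apply, AlgHom.toLinearMap_apply,
      LinearMap.applyₗ_apply_apply] at h hy ⊢
    rw [map_mul, Module.End.mul_apply, hy, twistedComul_ι_mul, h, LinearMap.add_apply]

section Expansion

variable (hR : R.Reproduces B) (hR' : R'.Reproduces B)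
include hR hR'

theorem coprod_tmul_eq_sum {mu : I → ℤ} (m : M) {m' : M'} (hm' : m' ∈ R'.V mu) (y : FF I) :
    R.coprod R' y (m ⊗ₜ m') = ∑ k, ∑ l, pair Ω (B.bs k * B.bs l) y •
      (brace Ω mu (toInt (B.deg l)))⁻¹ • (R.minus (B.b l) m ⊗ₜ[𝕜] R'.minus (B.b k) m') := by
  have hA : LinearMap.applyₗ m' ∘ₗ R'.minus.toLinearMap =
      ∑ k, (pair Ω (B.bs k)).smulRight (R'.minus (B.b k) m') := LinearMap.ext fun x => by
    simp [hR'.minus x, LinearMap.sum_apply]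
  have hA' : LinearMap.applyₗ m ∘ₗ (R.minus.comp (twist (braceRight Ω (-mu)))).toLinearMap =
      ∑ l, (pair Ω (B.bs l)).smulRight
        ((brace Ω mu (toInt (B.deg l)))⁻¹ • R.minus (B.b l) m) := LinearMap.ext fun x => by
    simp [hR.minus (twist _ x), LinearMap.sum_apply, ← pair_twist_left,
      twist_of_mem_homog _ (B.bs_mem _), brace_neg_left, smul_smul, mul_comm]
  simp only [coprod_tmul m hm', hA, hA', ← TensorProduct.mapBilinear_apply, map_sum,
    LinearMap.sum_apply, pair_mul_left]
  rw [Finset.sum_comm]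
  simp only [TensorProduct.mapBilinear_apply, map_smulRight, LinearMap.smulRight_apply,
    LinearMap.comp_apply, map_smul, TensorProduct.comm_tmul, ← TensorProduct.smul_tmul']

/-- `(Δ ⊗ 1)(Θ)` on `M ⊗ M' ⊗ M''`. -/
theorem sum_coprod_tmul_plus (hR'' : R''.Reproduces B) {mu : I → ℤ} (m : M) {m' : M'}
    (hm' : m' ∈ R'.V mu) (m'' : M'') :
    ∑ n, R.coprod R' (B.b n) (m ⊗ₜ m') ⊗ₜ[𝕜] R''.plus (B.bs n) m'' =
      ∑ k, ∑ l, (brace Ω mu (toInt (B.deg l)))⁻¹ •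
        ((R.minus (B.b l) m ⊗ₜ[𝕜] R'.minus (B.b k) m') ⊗ₜ[𝕜]
          R''.plus (B.bs k * B.bs l) m'') := by
  simp only [coprod_tmul_eq_sum hR hR' m hm', hR''.plus (_ * _), LinearMap.sum_apply,
    TensorProduct.sum_tmul, TensorProduct.tmul_sum, LinearMap.smul_apply, Finset.smul_sum]
  rw [Finset.sum_comm]
  refine Finset.sum_congr rfl fun k _ => ?_
  rw [Finset.sum_comm]
  simp only [TensorProduct.smul_tmul', TensorProduct.tmul_smul, smul_smul, mul_comm]

end Expansion

end WeightRep

/-! ### The braid relation -/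

namespace WeightRep

variable {I : Type u} [Fintype I] [DecidableEq I] {Ω : I → I → ℤ} {B : HomogFamily I}
  {M₁ : Type*} [AddCommGroup M₁] [Module 𝕜 M₁] {R₁ : WeightRep Ω M₁}
  {M₂ : Type*} [AddCommGroup M₂] [Module 𝕜 M₂] {R₂ : WeightRep Ω M₂}
  {M₃ : Type*} [AddCommGroup M₃] [Module 𝕜 M₃] {R₃ : WeightRep Ω M₃}
  {r₁₂ : M₁ ⊗[𝕜] M₂ →ₗ[𝕜] M₂ ⊗[𝕜] M₁} {r₁₃ : M₁ ⊗[𝕜] M₃ →ₗ[𝕜] M₃ ⊗[𝕜] M₁}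
  {r₂₃ : M₂ ⊗[𝕜] M₃ →ₗ[𝕜] M₃ ⊗[𝕜] M₂}

/-- The operator `Id ⊗ r` on a left-bracketed triple tensor product. -/
def onLast (M : Type*) [AddCommGroup M] [Module 𝕜 M] (r : M₁ ⊗[𝕜] M₂ →ₗ[𝕜] M₂ ⊗[𝕜] M₁) :
    (M ⊗[𝕜] M₁) ⊗[𝕜] M₂ →ₗ[𝕜] (M ⊗[𝕜] M₂) ⊗[𝕜] M₁ :=
  (TensorProduct.assoc 𝕜 M M₂ M₁).symm.toLinearMap ∘ₗ r.lTensor M ∘ₗ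
    (TensorProduct.assoc 𝕜 M M₁ M₂).toLinearMap

theorem onLast_tmul {M : Type*} [AddCommGroup M] [Module 𝕜 M]
    (r : M₁ ⊗[𝕜] M₂ →ₗ[𝕜] M₂ ⊗[𝕜] M₁) (m : M) (m₁ : M₁) (m₂ : M₂) :
    onLast M r ((m ⊗ₜ m₁) ⊗ₜ m₂) =
      (TensorProduct.assoc 𝕜 M M₂ M₁).symm (m ⊗ₜ r (m₁ ⊗ₜ m₂)) := rfl

/-- The hexagon identity: the right-hand side is the R-matrix of `M₁` and `M₂ ⊗ M₃`. -/
theorem onLast_rTensor_tmul (h₁ : R₁.Reproduces B) (h₂ : R₂.Reproduces B)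
    (h₃ : R₃.Reproduces B) (hr₁₂ : IsRMatrix R₁ R₂ B r₁₂) (hr₁₃ : IsRMatrix R₁ R₃ B r₁₃)
    {l₁ l₂ l₃ : I → ℤ} {m₁ : M₁} (hm₁ : m₁ ∈ R₁.V l₁) {m₂ : M₂} (hm₂ : m₂ ∈ R₂.V l₂) {m₃ : M₃}
    (hm₃ : m₃ ∈ R₃.V l₃) :
    onLast M₂ r₁₃ (r₁₂.rTensor M₃ ((m₁ ⊗ₜ m₂) ⊗ₜ m₃)) = (brace Ω (l₂ + l₃) l₁)⁻¹ •
      ∑ n, R₂.coprod R₃ (B.b n) (m₂ ⊗ₜ m₃) ⊗ₜ[𝕜] R₁.plus (B.bs n) m₁ := by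
  have hr (l : B.index) : r₁₃ (R₁.plus (B.bs l) m₁ ⊗ₜ m₃) =
      (brace Ω l₃ (l₁ + toInt (B.deg l)))⁻¹ •
        ∑ k, R₃.minus (B.b k) m₃ ⊗ₜ R₁.plus (B.bs k * B.bs l) m₁ := by
    rw [hr₁₃ _ _ _ (R₁.plus_mem (B.bs_mem l) hm₁) m₃ hm₃, theta_tmul]
    simp only [map_mul, Module.End.mul_apply]
  rw [sum_coprod_tmul_plus h₂ h₃ h₁ m₂ hm₃ m₁, LinearMap.rTensor_tmul, hr₁₂ _ _ _ hm₁ _ hm₂,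
    theta_tmul, Finset.sum_comm]
  simp only [← TensorProduct.smul_tmul', TensorProduct.sum_tmul, map_smul, map_sum, onLast_tmul,
    hr, TensorProduct.tmul_smul, TensorProduct.tmul_sum, TensorProduct.assoc_symm_tmul,
    Finset.smul_sum, smul_smul, brace_add_left, brace_add_right, mul_inv, mul_assoc]

theorem braid_tmul (h₁ : R₁.Reproduces B) (h₂ : R₂.Reproduces B) (h₃ : R₃.Reproduces B)
    (hr₁₂ : IsRMatrix R₁ R₂ B r₁₂) (hr₁₃ : IsRMatrix R₁ R₃ B r₁₃)
    (hr₂₃ : IsRMatrix R₂ R₃ B r₂₃) {l₁ l₂ l₃ : I → ℤ} {m₁ : M₁} (hm₁ : m₁ ∈ R₁.V l₁) {m₂ : M₂}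
    (hm₂ : m₂ ∈ R₂.V l₂) {m₃ : M₃} (hm₃ : m₃ ∈ R₃.V l₃) :
    r₂₃.rTensor M₁ (onLast M₂ r₁₃ (r₁₂.rTensor M₃ ((m₁ ⊗ₜ m₂) ⊗ₜ m₃))) =
      onLast M₃ r₁₂ (r₁₃.rTensor M₂ (onLast M₁ r₂₃ ((m₁ ⊗ₜ m₂) ⊗ₜ m₃))) := by
  have hweight (k : B.index) : l₃ - toInt (B.deg k) + (l₂ + toInt (B.deg k)) = l₂ + l₃ := by
    abel
  have hhexagon (k : B.index) : onLast M₃ r₁₂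
      (r₁₃ (m₁ ⊗ₜ R₃.minus (B.b k) m₃) ⊗ₜ R₂.plus (B.bs k) m₂) = (brace Ω (l₂ + l₃) l₁)⁻¹ •
        ∑ n, R₃.coprod R₂ (B.b n) (R₃.minus (B.b k) m₃ ⊗ₜ R₂.plus (B.bs k) m₂) ⊗ₜ
          R₁.plus (B.bs n) m₁ := by
    rw [← hweight k]
    exact onLast_rTensor_tmul h₁ h₃ h₂ hr₁₃ hr₁₂ hm₁ (R₃.minus_mem (B.b_mem k) hm₃)
      (R₂.plus_mem (B.bs_mem k) hm₂)
  rw [onLast_rTensor_tmul h₁ h₂ h₃ hr₁₂ hr₁₃ hm₁ hm₂ hm₃]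
  simp only [map_smul, map_sum, LinearMap.rTensor_tmul, hr₂₃.apply_coprod h₂ h₃, onLast_tmul,
    hr₂₃ _ _ _ hm₂ _ hm₃, theta_tmul, TensorProduct.tmul_smul, TensorProduct.tmul_sum,
    TensorProduct.assoc_symm_tmul, hhexagon, ← TensorProduct.smul_tmul', TensorProduct.sum_tmul,
    Finset.smul_sum]
  rw [Finset.sum_comm]
  simp only [smul_smul, mul_comm]

theorem braid (h₁ : R₁.Reproduces B) (h₂ : R₂.Reproduces B) (h₃ : R₃.Reproduces B)
    (hr₁₂ : IsRMatrix R₁ R₂ B r₁₂) (hr₁₃ : IsRMatrix R₁ R₃ B r₁₃)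
    (hr₂₃ : IsRMatrix R₂ R₃ B r₂₃) :
    r₂₃.rTensor M₁ ∘ₗ onLast M₂ r₁₃ ∘ₗ r₁₂.rTensor M₃ =
      onLast M₃ r₁₂ ∘ₗ r₁₃.rTensor M₂ ∘ₗ onLast M₁ r₂₃ := by
  refine TensorProduct.ext (R₁.tensor_ext R₂ fun l₁ l₂ m₁ hm₁ m₂ hm₂ =>
    R₃.linearMap_ext fun l₃ m₃ hm₃ => ?_)
  exact braid_tmul h₁ h₂ h₃ hr₁₂ hr₁₃ hr₂₃ hm₁ hm₂ hm₃

end WeightRep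

/-! ### Weight modules over `U_{v,t}` -/

theorem smul_smul_of_mul_mul_eq {k A M : Type*} [CommSemiring k] [Semiring A] [Algebra k A]
    [AddCommMonoid M] [Module k M] [Module A M] [IsScalarTower k A M] {x x' y : A} {c d : k}
    (h : x * y * x' = c • y) (h' : x' * x = 1) {m : M} (hm : x • m = d • m) :
    x • y • m = (c * d) • y • m := by
  have hxy : x * y = c • (y * x) := by
    rw [← smul_mul_assoc, ← h, mul_assoc _ x' x, h', mul_one]
  rw [smul_smul, hxy, smul_assoc, mul_smul y, hm, ← algebraMap_smul A d m, smul_smul,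
    ← Algebra.commutes, mul_smul (algebraMap k A d), algebraMap_smul, smul_smul]

section Modules

variable {I : Type u} [Fintype I] [DecidableEq I] {Ω : I → I → ℤ}
variable {M : Type*} [AddCommGroup M] [Module 𝕜 M] [Module (U Ω) M] [IsScalarTower 𝕜 (U Ω) M]

theorem brace_e_e (i j : I) :
    brace Ω (e i) (e j) = v ^ (Ω i j + Ω j i) * t ^ (Ω j i - Ω i j) := by
  simp only [brace, dot, ang_e_e]

theorem mem_weightSpace_iff {lam : I → ℤ} {m : M} : m ∈ weightSpace Ω M lam ↔ ∀ i,
    gen Ω (Gen.K i) • m = brace Ω (e i) lam • m ∧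
      gen Ω (Gen.K' i) • m = (brace Ω lam (e i))⁻¹ • m := by
  have h (i : I) : v ^ (-dot Ω (e i) lam) * cc Ω i lam = (brace Ω lam (e i))⁻¹ := by
    rw [brace, mul_inv, ← zpow_neg, ← zpow_neg, cc, neg_sub, dot, dot, add_comm]
  simp only [← h]
  rfl

theorem gen_F_smul_mem (j : I) {lam : I → ℤ} {m : M} (hm : m ∈ weightSpace Ω M lam) :
    gen Ω (Gen.F j) • m ∈ weightSpace Ω M (lam - e j) := by
  rw [mem_weightSpace_iff] at hm ⊢
  intro i
  constructor
  · have hF : gen Ω (Gen.K i) * gen Ω (Gen.F j) * gen Ω (Gen.Ki i) =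
        (brace Ω (e i) (e j))⁻¹ • gen Ω (Gen.F j) := by
      rw [brace_e_e, mul_inv, ← zpow_neg, ← zpow_neg, neg_sub]
      simpa only [gen, map_mul, map_smul] using mkU_rel Ω (Rel.K_F i j)
    have hK : gen Ω (Gen.Ki i) * gen Ω (Gen.K i) = 1 := by
      simpa only [gen, map_mul, map_one] using mkU_rel Ω (Rel.Ki_K i)
    rw [smul_smul_of_mul_mul_eq hF hK (hm i).1, brace_sub_right, mul_comm]
  · have hF : gen Ω (Gen.K' i) * gen Ω (Gen.F j) * gen Ω (Gen.Ki' i) =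
        brace Ω (e j) (e i) • gen Ω (Gen.F j) := by
      rw [brace_e_e, add_comm]
      simpa only [gen, map_mul, map_smul] using mkU_rel Ω (Rel.K'_F i j)
    have hK' : gen Ω (Gen.Ki' i) * gen Ω (Gen.K' i) = 1 := by
      simpa only [gen, map_mul, map_one] using mkU_rel Ω (Rel.Ki'_K' i)
    rw [smul_smul_of_mul_mul_eq hF hK' (hm i).2, brace_sub_left, mul_inv, inv_inv, mul_comm]

variable (Ω M) [IsWeightModule Ω M]

/-- The weight representation underlying a weight module over `U_{v,t}`. -/
def WeightRep.ofModule : WeightRep Ω M where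
  E i := act Ω M (gen Ω (Gen.E i))
  F i := act Ω M (gen Ω (Gen.F i))
  K i := act Ω M (gen Ω (Gen.K i))
  K' i := act Ω M (gen Ω (Gen.K' i))
  V := weightSpace Ω M
  iSupIndep_V := (IsWeightModule.isInternal (Ω := Ω) (M := M)).submodule_iSupIndep
  iSup_V := (IsWeightModule.isInternal (Ω := Ω) (M := M)).submodule_iSup_eq_top
  E_mem := gen_E_smul_mem
  F_mem i _ _ hm := gen_F_smul_mem i hm
  K_apply i _ _ hm := (mem_weightSpace_iff.1 hm i).1
  K'_apply i _ _ hm := (mem_weightSpace_iff.1 hm i).2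
  E_F_same i := by
    simp only [← map_mul, ← map_sub, ← map_smul]
    congr 1
    simpa only [gen, map_mul, map_smul, map_sub] using mkU_rel Ω (Rel.E_F_same i)
  E_F_ne i j h := by
    have hEF : gen Ω (Gen.E i) * gen Ω (Gen.F j) - gen Ω (Gen.F j) * gen Ω (Gen.E i) = 0 := by
      simpa only [gen, map_mul, map_zero, map_sub] using mkU_rel Ω (Rel.E_F_ne i j h)
    rw [← map_mul, ← map_mul, ← map_sub, hEF, map_zero]

theorem WeightRep.ofModule_plus : (ofModule Ω M).plus = (act Ω M).comp (TwoParam.plus Ω) := by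
  ext i : 2
  simp [WeightRep.plus, TwoParam.plus, ofModule]

theorem WeightRep.ofModule_minus : (ofModule Ω M).minus = (act Ω M).comp (TwoParam.minus Ω) := by
  ext i : 2
  simp [WeightRep.minus, TwoParam.minus, ofModule]

end Modules

/-! ### Dual bases -/

namespace WeightRep

variable {I : Type u} [Fintype I] [DecidableEq I] {Ω : I → I → ℤ} {M : Type*} [AddCommGroup M]
  [Module 𝕜 M] (R : WeightRep Ω M)

/-- The degrees in which `'f` acts nontrivially through the `E_i`. -/
def plusDegrees : Set (I → ℕ) := {mu | ∃ x ∈ homog mu, R.plus x ≠ 0}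

/-- The degrees in which `'f` acts nontrivially through the `E_i` or through the `F_i`. -/
def degrees : Set (I → ℕ) := R.plusDegrees ∪ R.swap.plusDegrees

theorem finite_plusDegrees [FiniteDimensional 𝕜 M] : R.plusDegrees.Finite := by
  refine ((R.finite_weights.image2 (fun a b => a - b) R.finite_weights).preimage
    toInt_injective.injOn).subset ?_
  rintro mu ⟨x, hx, hne⟩
  contrapose! hne with hmu
  refine R.linearMap_ext fun lam m hm => ?_
  by_contra h
  refine hmu ⟨_, ?_, lam, ?_, add_sub_cancel_left lam _⟩
  · exact (Submodule.ne_bot_iff _).2 ⟨_, R.plus_mem hx hm, h⟩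
  · exact (Submodule.ne_bot_iff _).2 ⟨m, hm, fun h0 => h (by rw [h0, map_zero, map_zero])⟩

theorem finite_degrees [FiniteDimensional 𝕜 M] : R.degrees.Finite :=
  R.finite_plusDegrees.union R.swap.finite_plusDegrees

end WeightRep

namespace DualBases

variable {I : Type u} [Fintype I] [DecidableEq I] {Ω : I → I → ℤ} (D : DualBases Ω)

/-- The dual bases in a finite set of degrees. -/
def family (S : Finset (I → ℕ)) : HomogFamily I where
  index := Σ mu : S, Fin (D.n mu)
  deg k := k.1
  b k := D.b k.1 k.2
  bs k := D.bstar k.1 k.2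
  b_mem _ := D.b_mem _ _
  bs_mem _ := D.bstar_mem _ _

theorem sum_family {S : Finset (I → ℕ)} {A : Type*} [AddCommMonoid A] (φ : FF I → FF I → A) :
    ∑ k, φ ((D.family S).b k) ((D.family S).bs k) =
      ∑ mu ∈ S, ∑ k, φ (D.b mu k) (D.bstar mu k) := by
  rw [← Finset.sum_coe_sort S]
  exact Fintype.sum_sigma _

theorem pair_eq_sum {mu : I → ℕ} {x y : FF I} (hx : x ∈ homog mu) (hy : y ∈ homog mu) :
    pair Ω x y = ∑ k, pair Ω x (D.b mu k) * pair Ω (D.bstar mu k) y := by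
  obtain ⟨c, hc⟩ := D.span mu y hy
  have hpair (z : FF I) (hz : z ∈ homog mu) :
      pair Ω z y = ∑ k, pair Ω z (D.b mu k) * c k := by
    simpa [sub_eq_zero, mul_comm] using hc z hz
  have hcoeff (k : Fin (D.n mu)) : pair Ω (D.bstar mu k) y = c k := by
    simp [hpair _ (D.bstar_mem mu k), D.dual]
  simp only [hcoeff, hpair x hx]

/-- The dual bases for the transposed datum. -/
def swap : DualBases (transp Ω) where
  n := D.n
  b := D.bstar
  bstar := D.b
  b_mem := D.bstar_mem
  bstar_mem := D.b_mem
  dual mu k l := by simp only [pair_transp, D.dual, eq_comm]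
  span mu x hx := ⟨fun k => pair Ω x (D.b mu k), fun y hy => by
    simp [pair_transp, D.pair_eq_sum hx hy, LinearMap.sum_apply]⟩

theorem pair_sub_sum_eq_zero {mu : I → ℕ} {x : FF I} (hx : x ∈ homog mu) (y : FF I) :
    pair Ω (x - ∑ k, pair Ω x (D.b mu k) • D.bstar mu k) y = 0 := by
  suffices h : pair Ω (x - ∑ k, pair Ω x (D.b mu k) • D.bstar mu k) = 0 by
    rw [h, LinearMap.zero_apply]
  refine linearMap_ext_word fun w => ?_
  have hw := word_mem_homog w
  by_cases hmu : mu = fun i => w.count i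
  · rw [← hmu] at hw
    simp [D.pair_eq_sum hx hw, LinearMap.sum_apply]
  · simp [pair_homog_eq_zero Ω hmu hx hw, pair_homog_eq_zero Ω hmu (D.bstar_mem mu _) hw,
      LinearMap.sum_apply]

variable {M : Type*} [AddCommGroup M] [Module 𝕜 M] [FiniteDimensional 𝕜 M] (R : WeightRep Ω M)

theorem plus_eq_sum_of_mem_homog (hΩ : HasCoroots Ω) {mu : I → ℕ} {x : FF I}
    (hx : x ∈ homog mu) :
    R.plus x = ∑ k, pair Ω x (D.b mu k) • R.plus (D.bstar mu k) := by
  have hz : x - ∑ k, pair Ω x (D.b mu k) • D.bstar mu k ∈ homog mu :=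
    Submodule.sub_mem _ hx <| Submodule.sum_mem _ fun k _ =>
      Submodule.smul_mem _ _ (D.bstar_mem mu k)
  have h := R.plus_eq_zero_of_pair_eq_zero hΩ hz (D.pair_sub_sum_eq_zero hx)
  simpa [sub_eq_zero] using h

theorem plus_eq_sum (hΩ : HasCoroots Ω) {S : Finset (I → ℕ)} (hS : R.plusDegrees ⊆ S)
    (x : FF I) :
    R.plus x = ∑ k, pair Ω x ((D.family S).b k) • R.plus ((D.family S).bs k) := by
  suffices h : R.plus.toLinearMap =
      ∑ k, ((pair Ω).flip ((D.family S).b k)).smulRight (R.plus ((D.family S).bs k)) by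
    simpa [LinearMap.sum_apply] using LinearMap.congr_fun h x
  refine linearMap_ext_word fun w => ?_
  set mu : I → ℕ := fun i => w.count i
  have hw : word w ∈ homog mu := word_mem_homog w
  have hother {nu : I → ℕ} (hnu : nu ≠ mu) :
      ∑ k, pair Ω (word w) (D.b nu k) • R.plus (D.bstar nu k) = 0 :=
    Finset.sum_eq_zero fun k _ => by
      rw [pair_homog_eq_zero Ω hnu.symm hw (D.b_mem nu k), zero_smul]
  simp only [AlgHom.toLinearMap_apply, LinearMap.sum_apply, LinearMap.smulRight_apply,
    LinearMap.flip_apply, D.sum_family fun b bs => pair Ω (word w) b • R.plus bs]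
  rw [Finset.sum_eq_single mu (fun _ _ => hother), ← D.plus_eq_sum_of_mem_homog R hΩ hw]
  intro hmu
  rw [← D.plus_eq_sum_of_mem_homog R hΩ hw]
  by_contra h
  exact hmu (hS ⟨_, hw, h⟩)

theorem reproduces (hΩ : HasCoroots Ω) {S : Finset (I → ℕ)} (hS : R.degrees ⊆ S) :
    R.Reproduces (D.family S) where
  plus := D.plus_eq_sum R hΩ (Set.subset_union_left.trans hS)
  minus y := by
    have h := D.swap.plus_eq_sum R.swap hΩ.transp (Set.subset_union_right.trans hS) y
    simp only [pair_transp] at h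
    exact h

end DualBases

section RMatrix

variable {I : Type u} [Fintype I] [DecidableEq I] {Ω : I → I → ℤ} (D : DualBases Ω)
variable (M : Type*) [AddCommGroup M] [Module 𝕜 M] [Module (U Ω) M] [IsScalarTower 𝕜 (U Ω) M]
  [IsWeightModule Ω M]
variable (M' : Type*) [AddCommGroup M'] [Module 𝕜 M'] [Module (U Ω) M']
  [IsScalarTower 𝕜 (U Ω) M'] [IsWeightModule Ω M']

theorem actTensor_theta (mu : I → ℕ) : actTensor Ω M M' (D.theta mu) =
    ∑ k, TensorProduct.map ((WeightRep.ofModule Ω M).minus (D.b mu k))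
      ((WeightRep.ofModule Ω M').plus (D.bstar mu k)) := by
  rw [DualBases.theta, map_sum, WeightRep.ofModule_minus, WeightRep.ofModule_plus]
  simp [actTensor]

theorem thetaOn_eq {S : Finset (I → ℕ)} (hS : (WeightRep.ofModule Ω M').plusDegrees ⊆ S) :
    thetaOn M M' D =
      (WeightRep.ofModule Ω M).theta (WeightRep.ofModule Ω M') (D.family S) := by
  rw [thetaOn, finsum_eq_sum_of_support_subset (s := S)]
  · simp only [actTensor_theta]
    exact (D.sum_family fun b bs => TensorProduct.map ((WeightRep.ofModule Ω M).minus b)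
      ((WeightRep.ofModule Ω M').plus bs)).symm
  · intro mu hmu
    by_contra hmuS
    refine hmu ?_
    have hplus (k : Fin (D.n mu)) : (WeightRep.ofModule Ω M').plus (D.bstar mu k) = 0 := by
      by_contra h
      exact hmuS (hS ⟨_, D.bstar_mem mu k, h⟩)
    simp [actTensor_theta, hplus]

theorem isRMatrix_rmat {S : Finset (I → ℕ)} (hS : (WeightRep.ofModule Ω M).plusDegrees ⊆ S) :
    WeightRep.IsRMatrix (WeightRep.ofModule Ω M) (WeightRep.ofModule Ω M') (D.family S)
      (rmat M M' D) := by
  intro lam mu m hm m' hm'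
  rw [rmat, thetaOn_eq D M' M hS, LinearMap.comp_apply, LinearMap.comp_apply,
    LinearEquiv.coe_coe, TensorProduct.comm_tmul, ftilde_tmul mu lam m' hm' m hm, map_smul, f]

end RMatrix

theorem mainTheorem2_general {I : Type*} [Fintype I] [DecidableEq I]
    (Ω : I → I → ℤ) (hΩ : HasCoroots Ω) (D : DualBases Ω)
    (M₁ M₂ M₃ : Type*)
    [AddCommGroup M₁] [Module 𝕜 M₁] [Module (U Ω) M₁] [IsScalarTower 𝕜 (U Ω) M₁]
    [FiniteDimensional 𝕜 M₁] [IsWeightModule Ω M₁]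
    [AddCommGroup M₂] [Module 𝕜 M₂] [Module (U Ω) M₂] [IsScalarTower 𝕜 (U Ω) M₂]
    [FiniteDimensional 𝕜 M₂] [IsWeightModule Ω M₂]
    [AddCommGroup M₃] [Module 𝕜 M₃] [Module (U Ω) M₃] [IsScalarTower 𝕜 (U Ω) M₃]
    [FiniteDimensional 𝕜 M₃] [IsWeightModule Ω M₃] :
    rmat12 M₂ M₃ M₁ D ∘ₗ rmat23 M₂ M₁ M₃ D ∘ₗ rmat12 M₁ M₂ M₃ D =
      rmat23 M₃ M₁ M₂ D ∘ₗ rmat12 M₁ M₃ M₂ D ∘ₗ rmat23 M₁ M₂ M₃ D := by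
  let R₁ := WeightRep.ofModule Ω M₁
  let R₂ := WeightRep.ofModule Ω M₂
  let R₃ := WeightRep.ofModule Ω M₃
  let S := R₁.finite_degrees.toFinset ∪ R₂.finite_degrees.toFinset ∪
    R₃.finite_degrees.toFinset
  have h₁ : R₁.degrees ⊆ S := fun mu h => by simp [S, h]
  have h₂ : R₂.degrees ⊆ S := fun mu h => by simp [S, h]
  have h₃ : R₃.degrees ⊆ S := fun mu h => by simp [S, h]
  have hplus₁ : R₁.plusDegrees ⊆ S := Set.subset_union_left.trans h₁
  have hplus₂ : R₂.plusDegrees ⊆ S := Set.subset_union_left.trans h₂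
  exact WeightRep.braid (D.reproduces R₁ hΩ h₁) (D.reproduces R₂ hΩ h₂) (D.reproduces R₃ hΩ h₃)
    (isRMatrix_rmat D M₁ M₂ hplus₁) (isRMatrix_rmat D M₁ M₃ hplus₁)
    (isRMatrix_rmat D M₂ M₃ hplus₂)

end TwoParam

end

open TwoParam in
theorem mainTheorem2 {I : Type*} [Fintype I] [DecidableEq I]
    (Ω : I → I → ℤ) (hΩ : IsCartan Ω) (D : DualBases Ω)
    (M₁ M₂ M₃ : Type*)
    [AddCommGroup M₁] [Module 𝕜 M₁] [Module (U Ω) M₁] [IsScalarTower 𝕜 (U Ω) M₁]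
    [FiniteDimensional 𝕜 M₁] [IsWeightModule Ω M₁]
    [AddCommGroup M₂] [Module 𝕜 M₂] [Module (U Ω) M₂] [IsScalarTower 𝕜 (U Ω) M₂]
    [FiniteDimensional 𝕜 M₂] [IsWeightModule Ω M₂]
    [AddCommGroup M₃] [Module 𝕜 M₃] [Module (U Ω) M₃] [IsScalarTower 𝕜 (U Ω) M₃]
    [FiniteDimensional 𝕜 M₃] [IsWeightModule Ω M₃] :
    rmat12 M₂ M₃ M₁ D ∘ₗ rmat23 M₂ M₁ M₃ D ∘ₗ rmat12 M₁ M₂ M₃ D =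
      rmat23 M₃ M₁ M₂ D ∘ₗ rmat12 M₁ M₃ M₂ D ∘ₗ rmat23 M₁ M₂ M₃ D :=
  mainTheorem2_general Ω hΩ.hasCoroots D M₁ M₂ M₃
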